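/- Let $n\ge 3$, $m\ge 1$, let $U\subset\mathbb R^n$ be open, fix a hyperplane $\mathcal P_0\subset\mathbb R^n$, and let $\varphi:[0,\infty)\to[0,\infty)$ be increasing (not necessarily strictly) with $\varphi(0)=0$ and $$\int_1^\infty\left[\frac{t}{\varphi(t)}\right]^{\frac1{n-2}}dt<\infty .$$ Let $f:U\to\mathbb R^m$ be continuous and of class $W^{1,\varphi}_{\rm loc}(U)$, i.e. $f$ has locally integrable first distributional derivatives in $U$ and $\int_K\varphi(|\nabla f|)\,dx<\infty$ for every compact $K\subset U$, where $|\nabla f|=\big(\sum_{i,j}(\partial f_i/\partial x_j)^2\big)^{1/2}$. Let $H^{n-1}$ denote the $(n-1)$-dimensional Hausdorff measure. Then, for almost every hyperplane $\mathcal P$ parallel to $\mathcal P_0$ (with respect to Lebesgue measure on a line orthogonal to $\mathcal P_0$): 1. $f$ has the $(N)$-property on $\mathcal P\cap U$: $H^{n-1}(f(E))=0$ for every $E\subset\mathcal P\cap U$ with $H^{n-1}(E)=0$; 2. $f$ is locally absolutely continuous on $\mathcal P\cap U$ with respect to $H^{n-1}$: for every compact $K\subset\mathcal P\cap U$ and every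 $\varepsilon>0$ there is $\delta>0$ such that $H^{n-1}(f(E))<\varepsilon$ for every $E\subset K$ with $H^{n-1}(E)<\delta$. Moreover, for every representative of the distributional gradient $\nabla f$, for almost every hyperplane $\mathcal P$ parallel to $\mathcal P_0$ one has $H^{n-1}(f(E))=0$ for every $E\subset\mathcal P\cap U$ such that $|\nabla f|=0$ on $E$, and even for every $E\subset\mathcal P\cap U$ on which only the derivatives of $f$ in the directions of $\mathcal P$, taken from that representative, vanish. In particular, all these conclusions hold for every continuous $f:U\to\mathbb R^m$ of class $W^{1,p}_{\rm loc}(U)$ (the case $\varphi(t)=t^p$) with $p>n-1$. -/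

import Mathlib

open MeasureTheory Set
open scoped ENNReal ContDiff

namespace OrliczSobolev

/-- The norm `|∇f| = √(∑ᵢⱼ (∂fᵢ/∂xⱼ)²)` of a derivative `L : ℝⁿ → ℝᵐ`, whose matrix entries are
`(L eⱼ)ᵢ`. -/
noncomputable def gradNorm {n m : ℕ}
    (L : EuclideanSpace ℝ (Fin n) →L[ℝ] EuclideanSpace ℝ (Fin m)) : ℝ :=
  Real.sqrt (∑ i : Fin m, ∑ j : Fin n, (L (EuclideanSpace.single j (1 : ℝ)) i) ^ 2)

/-- `g` is (a representative of) the distributional derivative of `f` on the open set `U`: both are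
locally integrable on `U`, and `∫ (∂ᵥψ) f = - ∫ ψ (g v)` for all smooth `ψ` with compact support
in `U` and all vectors `v`. -/
structure IsWeakDeriv {n m : ℕ} (U : Set (EuclideanSpace ℝ (Fin n)))
    (f : EuclideanSpace ℝ (Fin n) → EuclideanSpace ℝ (Fin m))
    (g : EuclideanSpace ℝ (Fin n) →
      EuclideanSpace ℝ (Fin n) →L[ℝ] EuclideanSpace ℝ (Fin m)) : Prop where
  locallyIntegrableOn : LocallyIntegrableOn f U volume
  locallyIntegrableOn_deriv : LocallyIntegrableOn g U volume
  integral_eq : ∀ ψ : EuclideanSpace ℝ (Fin n) → ℝ,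
    ContDiff ℝ ∞ ψ → HasCompactSupport ψ → tsupport ψ ⊆ U →
    ∀ v : EuclideanSpace ℝ (Fin n),
      ∫ x, (fderiv ℝ ψ x v) • f x = - ∫ x, ψ x • g x v

/-- The class `W^{1,φ}_loc(U)`: the distributional derivative exists as a locally integrable
function, and `φ(|∇f|)` is integrable on compact subsets of `U`. -/
def MemOrliczSobolevLoc {n m : ℕ} (φ : ℝ → ℝ) (U : Set (EuclideanSpace ℝ (Fin n)))
    (f : EuclideanSpace ℝ (Fin n) → EuclideanSpace ℝ (Fin m)) : Prop :=
  ∃ g, IsWeakDeriv U f g ∧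
    ∀ K ⊆ U, IsCompact K → ∫⁻ x in K, ENNReal.ofReal (φ (gradNorm (g x))) < ⊤

/-- The class `W^{1,p}_loc(U)`, which is `W^{1,φ}_loc(U)` for `φ(t) = t^p`. -/
def MemSobolevLoc {n m : ℕ} (p : ℝ) (U : Set (EuclideanSpace ℝ (Fin n)))
    (f : EuclideanSpace ℝ (Fin n) → EuclideanSpace ℝ (Fin m)) : Prop :=
  MemOrliczSobolevLoc (fun t => t ^ p) U f

/-- The hyperplane with unit normal `ν` at signed distance `t` from the origin. For fixed `ν` these
are all the hyperplanes parallel to a fixed one, and "almost every" refers to Lebesgue measure in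
the parameter `t`, the coordinate along the orthogonal line. -/
def hyperplane {n : ℕ} (ν : EuclideanSpace ℝ (Fin n)) (t : ℝ) : Set (EuclideanSpace ℝ (Fin n)) :=
  {x | inner ℝ ν x = t}

/-- Lusin's `(N)`-property of `f` on `S` with respect to `d`-dimensional Hausdorff measure. -/
def LusinN {n m : ℕ} (d : ℝ) (f : EuclideanSpace ℝ (Fin n) → EuclideanSpace ℝ (Fin m))
    (S : Set (EuclideanSpace ℝ (Fin n))) : Prop :=
  ∀ E ⊆ S, Measure.hausdorffMeasure d E = 0 → Measure.hausdorffMeasure d (f '' E) = 0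

/-- Local absolute continuity of `f` on `S` with respect to `d`-dimensional Hausdorff measure:
on every compact subset of `S`, the measure of `f(E)` is small whenever that of `E` is. -/
def LocallyAC {n m : ℕ} (d : ℝ) (f : EuclideanSpace ℝ (Fin n) → EuclideanSpace ℝ (Fin m))
    (S : Set (EuclideanSpace ℝ (Fin n))) : Prop :=
  ∀ K ⊆ S, IsCompact K → ∀ ε : ℝ≥0∞, 0 < ε → ∃ δ : ℝ≥0∞, 0 < δ ∧
    ∀ E ⊆ K, Measure.hausdorffMeasure d E < δ → Measure.hausdorffMeasure d (f '' E) < ε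

/-- The properties of `f` on almost all hyperplanes orthogonal to `ν`: the `(N)`-property, local
absolute continuity, and the vanishing of the image of sets on which the gradient, or merely its
restriction to the directions of the hyperplane, vanishes. The last two hold for every
representative `g` of the distributional derivative. -/
def LusinSardOnHyperplanes {n m : ℕ} (U : Set (EuclideanSpace ℝ (Fin n)))
    (f : EuclideanSpace ℝ (Fin n) → EuclideanSpace ℝ (Fin m))
    (ν : EuclideanSpace ℝ (Fin n)) : Prop :=
  (∀ᵐ t : ℝ, LusinN ((n : ℝ) - 1) f (hyperplane ν t ∩ U) ∧
    LocallyAC ((n : ℝ) - 1) f (hyperplane ν t ∩ U)) ∧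
  (∀ g, IsWeakDeriv U f g → ∀ᵐ t : ℝ, ∀ E ⊆ hyperplane ν t ∩ U,
    ((∀ x ∈ E, gradNorm (g x) = 0) →
      Measure.hausdorffMeasure ((n : ℝ) - 1) (f '' E) = 0) ∧
    ((∀ x ∈ E, ∀ v, inner ℝ ν v = 0 → g x v = 0) →
      Measure.hausdorffMeasure ((n : ℝ) - 1) (f '' E) = 0))

end OrliczSobolev

/-!
On almost every hyperplane parallel to a fixed one the restriction of `f` satisfies a pointwise
oscillation estimate, and the three conclusions follow from it by a covering argument. Write
`k = n - 1`, so that the hyperplanes are copies of `ℝᵏ`.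

*Restriction.* For a fixed vector `v`, testing the weak derivative `g` against the translates of a
test function along `v` gives `f (x + v) - f x = ∫₀¹ g (x + τ v) v dτ` for almost every `x`
(`IsWeakDeriv.ae_sub_eq_integral`). Only the countably many dyadic vectors `v` parallel to the
hyperplane are needed, so by Fubini these identities hold on almost every hyperplane simultaneously
(`ae_isDyadicGradientBound`). No smoothing of `f` and no Sobolev space on the hyperplane are
involved.

*Oscillation.* On a hyperplane, let `h` be the norm of the tangential derivative. The children of a
dyadic cube `Q` are translates of each other by dyadic vectors, so the identities above bound the
difference between the averages over `Q` and over one of its children of the restriction `u` of `f`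
by a constant times `ℓ(Q)^{1-k} ∫_Q h`, where `ℓ(Q)` is the side of `Q`. Since `u` is continuous,
telescoping along the cubes `Q_j(x)` of side `2^{-j}` shrinking to `x` bounds `|u(x) - u_Q|` by a
constant times `∑_j 2^{j(k-1)} ∫_{Q_j(x)} h`. Split `h` by its size into the shells `{2^{i-1} < h ≤
2^i}`, with one more shell `{0 < h ≤ 1}`: a shell that meets `Q` in measure `e` contributes at most
a constant times `2^i e^{1/k}`, and Hölder's inequality with exponents `k` and `k/(k-1)` sums these
contributions. The second Hölder factor is finite because `∫ (t/φ(t))^{1/(k-1)} dt` converges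
(`orliczSum_lt_top`). The result is `diam(u(Q))^k ≤ C ∫_Q Φ(h)` with the weight `Φ(t) = 1_{t>0} +
φ(t)` (`ediam_image_dyadicCube_pow_le`).

*Covering.* Decomposing an open set `W` into its maximal small dyadic cubes gives `H^k(u(W)) ≤ C ∫_W
Φ(h)` (`hausdorffMeasure_image_le`). As `Φ(h)` is locally integrable on almost every hyperplane,
absolute continuity of the integral yields local absolute continuity and hence the `(N)`-property.
As `Φ(0) = 0`, the zero set of `h` has open neighbourhoods over which the integral of `Φ(h)` is
arbitrarily small, so its image is null; a set on which another representative of the gradient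
vanishes differs from a subset of it by a null set, which the `(N)`-property handles.
-/

namespace OrliczSobolev

/-! ### Dyadic cubes -/

/-- The integer coordinates of the dyadic cube of side `2⁻ʲ` that contains `x`. -/
noncomputable def dyadicIndex {k : ℕ} (j : ℕ) (x : Fin k → ℝ) : Fin k → ℤ :=
  fun i => ⌊(2 : ℝ) ^ j * x i⌋

/-- The half-open dyadic cube of side `2⁻ʲ` with integer coordinates `a`. -/
def dyadicCube {k : ℕ} (j : ℕ) (a : Fin k → ℤ) : Set (Fin k → ℝ) :=
  {x | dyadicIndex j x = a}

section
variable {k : ℕ}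

theorem mem_dyadicCube_self (j : ℕ) (x : Fin k → ℝ) : x ∈ dyadicCube j (dyadicIndex j x) := rfl

theorem measurable_dyadicIndex (j : ℕ) : Measurable (dyadicIndex (k := k) j) := by
  unfold dyadicIndex
  fun_prop

theorem measurableSet_dyadicCube (j : ℕ) (a : Fin k → ℤ) : MeasurableSet (dyadicCube j a) :=
  measurable_dyadicIndex j (measurableSet_singleton a)

theorem dyadicCube_eq_pi (j : ℕ) (a : Fin k → ℤ) :
    dyadicCube j a =
      Set.pi univ fun i => Ico ((a i : ℝ) / 2 ^ j) (((a i : ℝ) + 1) / 2 ^ j) := by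
  ext x
  have h2 : (0 : ℝ) < 2 ^ j := by positivity
  simp only [dyadicCube, dyadicIndex, mem_ofPred_eq, funext_iff, Int.floor_eq_iff, mem_pi, mem_univ,
    mem_Ico, true_imp_iff, div_le_iff₀ h2, lt_div_iff₀ h2, mul_comm]

theorem convex_dyadicCube (j : ℕ) (a : Fin k → ℤ) : Convex ℝ (dyadicCube j a) := by
  rw [dyadicCube_eq_pi]
  exact convex_pi fun i _ => convex_Ico _ _

theorem volume_dyadicCube (j : ℕ) (a : Fin k → ℤ) :
    volume (dyadicCube j a) = ((2 : ℝ≥0∞) ^ (j * k))⁻¹ := by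
  rw [dyadicCube_eq_pi, Real.volume_pi_Ico]
  have : ∀ i, ENNReal.ofReal (((a i : ℝ) + 1) / 2 ^ j - (a i : ℝ) / 2 ^ j)
      = ((2 : ℝ≥0∞) ^ j)⁻¹ := by
    intro i
    rw [← sub_div, add_sub_cancel_left, one_div, ENNReal.ofReal_inv_of_pos (by positivity),
      ENNReal.ofReal_pow (by norm_num)]
    norm_num
  simp only [this, Finset.prod_const, Finset.card_univ, Fintype.card_fin]
  rw [← ENNReal.inv_pow, pow_mul]

theorem dist_le_of_mem_dyadicCube {j : ℕ} {a : Fin k → ℤ} {x y : Fin k → ℝ}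
    (hx : x ∈ dyadicCube j a) (hy : y ∈ dyadicCube j a) : dist x y ≤ (1 / 2) ^ j := by
  rw [dyadicCube_eq_pi] at hx hy
  refine (dist_pi_le_iff (by positivity)).2 fun i => ?_
  obtain ⟨h1, h2⟩ := hx i (mem_univ _)
  obtain ⟨h3, h4⟩ := hy i (mem_univ _)
  rw [add_div] at h2 h4
  rw [one_div_pow, Real.dist_eq, abs_le]
  constructor <;> linarith

theorem isCompact_closure_dyadicCube (j : ℕ) (a : Fin k → ℤ) :
    IsCompact (closure (dyadicCube j a)) :=
  (Metric.isBounded_iff.2 ⟨_, fun _ hx _ hy =>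
    dist_le_of_mem_dyadicCube hx hy⟩).isCompact_closure

theorem dyadicIndex_succ_div_two (j : ℕ) (x : Fin k → ℝ) (i : Fin k) :
    dyadicIndex (j + 1) x i / 2 = dyadicIndex j x i := by
  symm
  simp only [dyadicIndex]
  rw [Int.floor_eq_iff]
  have h1 := Int.floor_le ((2 : ℝ) ^ (j + 1) * x i)
  have h2 := Int.lt_floor_add_one ((2 : ℝ) ^ (j + 1) * x i)
  set q := ⌊(2 : ℝ) ^ (j + 1) * x i⌋
  have h3 : 2 * (q / 2) ≤ q := by omega
  have h4 : q + 1 ≤ 2 * (q / 2) + 2 := by omega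
  have h3' : (2 : ℝ) * ((q / 2 : ℤ) : ℝ) ≤ q := by exact_mod_cast h3
  have h4' : (q : ℝ) + 1 ≤ 2 * ((q / 2 : ℤ) : ℝ) + 2 := by exact_mod_cast h4
  rw [pow_succ] at h1 h2
  constructor <;> nlinarith

theorem dyadicIndex_eq_of_succ {j : ℕ} {x y : Fin k → ℝ}
    (h : dyadicIndex (j + 1) x = dyadicIndex (j + 1) y) : dyadicIndex j x = dyadicIndex j y := by
  funext i
  rw [← dyadicIndex_succ_div_two j x, ← dyadicIndex_succ_div_two j y, h]

theorem dyadicIndex_eq_of_le {i j : ℕ} (hij : i ≤ j) {x y : Fin k → ℝ}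
    (h : dyadicIndex j x = dyadicIndex j y) : dyadicIndex i x = dyadicIndex i y := by
  induction j, hij using Nat.le_induction with
  | base => exact h
  | succ j _ ih => exact ih (dyadicIndex_eq_of_succ h)

theorem dyadicCube_subset_of_le {i j : ℕ} (hij : i ≤ j) (x : Fin k → ℝ) :
    dyadicCube j (dyadicIndex j x) ⊆ dyadicCube i (dyadicIndex i x) :=
  fun _ hy => dyadicIndex_eq_of_le hij hy

/-- The indices of the `2ᵏ` dyadic cubes of the next generation inside the cube with index `a`. -/
def dyadicChildren (a : Fin k → ℤ) : Finset (Fin k → ℤ) :=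
  Fintype.piFinset fun i => {2 * a i, 2 * a i + 1}

theorem mem_dyadicChildren {a b : Fin k → ℤ} :
    b ∈ dyadicChildren a ↔ ∀ i, b i / 2 = a i := by
  simp only [dyadicChildren, Fintype.mem_piFinset, Finset.mem_insert, Finset.mem_singleton]
  refine forall_congr' fun i => ?_
  omega

theorem card_dyadicChildren (a : Fin k → ℤ) : (dyadicChildren a).card = 2 ^ k := by
  simp only [dyadicChildren, Fintype.card_piFinset]
  rw [Finset.prod_congr rfl fun i _ => Finset.card_pair (by omega)]
  simp

theorem dyadicCube_eq_biUnion_children (j : ℕ) (a : Fin k → ℤ) :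
    dyadicCube j a = ⋃ b ∈ dyadicChildren a, dyadicCube (j + 1) b := by
  ext x
  simp only [mem_iUnion, exists_prop, mem_dyadicChildren]
  constructor
  · rintro rfl
    exact ⟨_, dyadicIndex_succ_div_two j x, rfl⟩
  · rintro ⟨b, hb, rfl⟩
    funext i
    rw [← dyadicIndex_succ_div_two, hb]

theorem dyadicCube_child_subset {j : ℕ} {a b : Fin k → ℤ} (hb : b ∈ dyadicChildren a) :
    dyadicCube (j + 1) b ⊆ dyadicCube j a := by
  rw [dyadicCube_eq_biUnion_children j a]
  exact subset_biUnion_of_mem (u := fun b => dyadicCube (j + 1) b) hb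

theorem disjoint_dyadicCube (j : ℕ) {a b : Fin k → ℤ} (h : a ≠ b) :
    Disjoint (dyadicCube j a) (dyadicCube j b) :=
  Set.disjoint_left.2 fun _ h1 h2 => h (h1.symm.trans h2)

/-- The point of the grid `2⁻ʲ ℤᵏ` with integer coordinates `c`. -/
noncomputable def dyadicPoint (j : ℕ) (c : Fin k → ℤ) : Fin k → ℝ := fun i => (c i : ℝ) / 2 ^ j

theorem preimage_add_dyadicPoint (j : ℕ) (a c : Fin k → ℤ) :
    (fun y => y + dyadicPoint j c) ⁻¹' dyadicCube j a = dyadicCube j (a - c) := by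
  ext y
  have : dyadicIndex j (y + dyadicPoint j c) = dyadicIndex j y + c := by
    funext i
    simp only [dyadicIndex, dyadicPoint, Pi.add_apply]
    rw [mul_add, mul_div_cancel₀ _ (by positivity), Int.floor_add_intCast]
  simp only [mem_preimage, dyadicCube, mem_ofPred_eq, this, eq_sub_iff_add_eq]

theorem norm_dyadicPoint_sub_le {j : ℕ} {a b c : Fin k → ℤ} (hb : b ∈ dyadicChildren a)
    (hc : c ∈ dyadicChildren a) : ‖dyadicPoint (j + 1) (c - b)‖ ≤ (1 / 2) ^ (j + 1) := by
  refine (pi_norm_le_iff_of_nonneg (by positivity)).2 fun i => ?_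
  rw [mem_dyadicChildren] at hb hc
  have h : |c i - b i| ≤ 1 := by
    have h1 := hb i
    have h2 := hc i
    rw [abs_le]
    omega
  have h' : |((c i - b i : ℤ) : ℝ)| ≤ 1 := by exact_mod_cast h
  simp only [dyadicPoint, Pi.sub_apply]
  rw [Real.norm_eq_abs, abs_div, abs_of_pos (by positivity : (0 : ℝ) < 2 ^ (j + 1)), one_div_pow]
  gcongr

end

/-! ### Averages over dyadic cubes -/

/-- The bound `‖u (y + w) - u y‖ ≤ k ‖w‖ ∫₀¹ H (y + τ w) dτ` for every dyadic vector `w` and almost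
every `y` such that the segment from `y` to `y + w` stays in `O`. -/
def IsDyadicGradientBound {k : ℕ} {Y : Type*} [NormedAddCommGroup Y] (O : Set (Fin k → ℝ))
    (u : (Fin k → ℝ) → Y) (H : (Fin k → ℝ) → ℝ≥0∞) : Prop :=
  ∀ (j : ℕ) (c : Fin k → ℤ), ∀ᵐ y : Fin k → ℝ,
    (∀ τ ∈ Icc (0 : ℝ) 1, y + τ • dyadicPoint j c ∈ O) →
      ‖u (y + dyadicPoint j c) - u y‖ₑ ≤
        k * ‖dyadicPoint j c‖ₑ * ∫⁻ τ in Icc (0 : ℝ) 1, H (y + τ • dyadicPoint j c)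

/-- The average of `u` over the dyadic cube of side `2⁻ʲ` that contains `x`. -/
noncomputable def dyadicAverage {k : ℕ} {Y : Type*} [NormedAddCommGroup Y] [NormedSpace ℝ Y]
    (u : (Fin k → ℝ) → Y) (j : ℕ) (x : Fin k → ℝ) : Y :=
  ((2 : ℝ) ^ (j * k)) • ∫ y in dyadicCube j (dyadicIndex j x), u y

section
variable {k : ℕ} {Y : Type*} [NormedAddCommGroup Y]
  {O : Set (Fin k → ℝ)} {u : (Fin k → ℝ) → Y} {H : (Fin k → ℝ) → ℝ≥0∞}

theorem integrableOn_dyadicCube (hu : ContinuousOn u O) {j : ℕ} {a : Fin k → ℤ}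
    (hQ : closure (dyadicCube j a) ⊆ O) : IntegrableOn u (dyadicCube j a) :=
  ((hu.mono hQ).integrableOn_compact (isCompact_closure_dyadicCube j a)).mono_set subset_closure

/-- Translating a dyadic cube along the segments joining it to a sibling keeps it inside their
parent, so Fubini bounds the difference of the integrals of `u` by an integral over the parent. -/
theorem lintegral_enorm_sub_translate_le (hH : Measurable H) (hD : IsDyadicGradientBound O u H)
    {j : ℕ} {a b c : Fin k → ℤ} (hQ : dyadicCube j a ⊆ O)
    (hb : b ∈ dyadicChildren a) (hc : c ∈ dyadicChildren a) :
    ∫⁻ y in dyadicCube (j + 1) b, ‖u (y + dyadicPoint (j + 1) (c - b)) - u y‖ₑ ≤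
      k * ((2 : ℝ≥0∞) ^ (j + 1))⁻¹ * ∫⁻ z in dyadicCube j a, H z := by
  set w := dyadicPoint (j + 1) (c - b) with hw
  have hseg : ∀ y ∈ dyadicCube (j + 1) b, ∀ τ ∈ Icc (0 : ℝ) 1, y + τ • w ∈ dyadicCube j a := by
    intro y hy τ hτ
    have h1 : y + w ∈ dyadicCube j a := by
      refine dyadicCube_child_subset hc ?_
      have : y ∈ (fun y => y + w) ⁻¹' dyadicCube (j + 1) c := by
        rw [hw, preimage_add_dyadicPoint, sub_sub_cancel]
        exact hy
      exact this
    exact (convex_dyadicCube j a).add_smul_mem (dyadicCube_child_subset hb hy) h1 hτ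
  have hwn : ‖w‖ₑ ≤ ((2 : ℝ≥0∞) ^ (j + 1))⁻¹ := by
    have h := norm_dyadicPoint_sub_le (j := j) hb hc
    rw [← hw] at h
    rw [← ofReal_norm]
    refine (ENNReal.ofReal_le_ofReal h).trans_eq ?_
    rw [one_div_pow, one_div, ENNReal.ofReal_inv_of_pos (by positivity),
      ENNReal.ofReal_pow (by norm_num)]
    norm_num
  have hmeas : Measurable fun p : (Fin k → ℝ) × ℝ => H (p.1 + p.2 • w) := by fun_prop
  calc ∫⁻ y in dyadicCube (j + 1) b, ‖u (y + w) - u y‖ₑ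
      ≤ ∫⁻ y in dyadicCube (j + 1) b, k * ‖w‖ₑ * ∫⁻ τ in Icc (0 : ℝ) 1, H (y + τ • w) := by
        refine setLIntegral_mono_ae' (measurableSet_dyadicCube _ _) ?_
        filter_upwards [hD (j + 1) (c - b)] with y hy hyQ
        exact hy fun τ hτ => hQ (hseg y hyQ τ hτ)
    _ = k * ‖w‖ₑ * ∫⁻ τ in Icc (0 : ℝ) 1, ∫⁻ y in dyadicCube (j + 1) b, H (y + τ • w) := by
        rw [lintegral_const_mul, lintegral_lintegral_swap]
        · exact hmeas.aemeasurable
        · exact hmeas.lintegral_prod_right'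
    _ ≤ k * ‖w‖ₑ * ∫⁻ τ in Icc (0 : ℝ) 1, ∫⁻ z in dyadicCube j a, H z := by
        refine mul_le_mul' le_rfl (setLIntegral_mono' measurableSet_Icc fun τ hτ => ?_)
        have hmp : MeasurePreserving (fun y : Fin k → ℝ => y + τ • w) :=
          measurePreserving_add_right volume _
        rw [← lintegral_indicator (measurableSet_dyadicCube _ _),
          ← lintegral_indicator (measurableSet_dyadicCube _ _),
          ← hmp.lintegral_comp (hH.indicator (measurableSet_dyadicCube j a))]
        refine lintegral_mono fun y => ?_
        by_cases hy : y ∈ dyadicCube (j + 1) b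
        · rw [indicator_of_mem hy, indicator_of_mem (hseg y hy τ hτ)]
        · rw [indicator_of_notMem hy]
          exact zero_le
    _ ≤ k * ((2 : ℝ≥0∞) ^ (j + 1))⁻¹ * ∫⁻ z in dyadicCube j a, H z := by
        rw [setLIntegral_const, Real.volume_Icc]
        simp only [sub_zero, ENNReal.ofReal_one, mul_one]
        gcongr

variable [NormedSpace ℝ Y]

theorem enorm_dyadicAverage_sub_succ_le (hk : 1 ≤ k) (hu : ContinuousOn u O) (hH : Measurable H)
    (hD : IsDyadicGradientBound O u H) (j : ℕ) (x : Fin k → ℝ)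
    (hQ : closure (dyadicCube j (dyadicIndex j x)) ⊆ O) :
    ‖dyadicAverage u j x - dyadicAverage u (j + 1) x‖ₑ ≤
      k * 2 ^ k * (((2 : ℝ≥0∞) ^ j) ^ (k - 1) *
        ∫⁻ z in dyadicCube j (dyadicIndex j x), H z) := by
  set a := dyadicIndex j x
  set b := dyadicIndex (j + 1) x
  have hb : b ∈ dyadicChildren a := mem_dyadicChildren.2 (dyadicIndex_succ_div_two j x)
  have hint : ∀ c ∈ dyadicChildren a, IntegrableOn u (dyadicCube (j + 1) c) := fun c hc =>
    (integrableOn_dyadicCube hu hQ).mono_set (dyadicCube_child_subset hc)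
  have htr : ∀ c ∈ dyadicChildren a,
      IntegrableOn (fun y => u (y + dyadicPoint (j + 1) (c - b))) (dyadicCube (j + 1) b) ∧
      ∫ y in dyadicCube (j + 1) b, u (y + dyadicPoint (j + 1) (c - b)) =
        ∫ y in dyadicCube (j + 1) c, u y := by
    intro c hc
    have hmp : MeasurePreserving (fun y : Fin k → ℝ => y + dyadicPoint (j + 1) (c - b)) :=
      measurePreserving_add_right volume _
    have hemb : MeasurableEmbedding (fun y : Fin k → ℝ => y + dyadicPoint (j + 1) (c - b)) :=
      measurableEmbedding_addRight _
    have hpre := preimage_add_dyadicPoint (j + 1) c (c - b)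
    rw [sub_sub_cancel] at hpre
    constructor
    · have := (hmp.integrableOn_comp_preimage hemb (s := dyadicCube (j + 1) c)).2 (hint c hc)
      rwa [hpre] at this
    · have := hmp.setIntegral_preimage_emb hemb u (dyadicCube (j + 1) c)
      rwa [hpre] at this
  have hsum : (∫ y in dyadicCube j a, u y) - (2 : ℝ) ^ k • ∫ y in dyadicCube (j + 1) b, u y =
      ∑ c ∈ dyadicChildren a,
        ∫ y in dyadicCube (j + 1) b, (u (y + dyadicPoint (j + 1) (c - b)) - u y) := by
    have h1 : ∫ y in dyadicCube j a, u y =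
        ∑ c ∈ dyadicChildren a, ∫ y in dyadicCube (j + 1) c, u y := by
      rw [dyadicCube_eq_biUnion_children, integral_biUnion_finset]
      · exact fun c _ => measurableSet_dyadicCube _ _
      · exact fun c _ d _ hcd => disjoint_dyadicCube _ hcd
      · exact hint
    rw [Finset.sum_congr rfl fun c hc => integral_sub (htr c hc).1 (hint b hb),
      Finset.sum_sub_distrib, Finset.sum_congr rfl fun c hc => (htr c hc).2, ← h1,
      Finset.sum_const, card_dyadicChildren, ← Nat.cast_smul_eq_nsmul ℝ]
    push_cast
    rfl
  have havg : dyadicAverage u j x - dyadicAverage u (j + 1) x =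
      ((2 : ℝ) ^ (j * k)) •
        ((∫ y in dyadicCube j a, u y) - (2 : ℝ) ^ k • ∫ y in dyadicCube (j + 1) b, u y) := by
    rw [dyadicAverage, dyadicAverage, smul_sub, smul_smul, ← pow_add, add_mul, one_mul]
  rw [havg, hsum, enorm_smul]
  have h2 : ‖(2 : ℝ) ^ (j * k)‖ₑ = (2 : ℝ≥0∞) ^ (j * k) := by
    rw [enorm_pow, Real.enorm_eq_ofReal (by norm_num)]
    norm_num
  rw [h2]
  calc (2 : ℝ≥0∞) ^ (j * k) * ‖∑ c ∈ dyadicChildren a,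
        ∫ y in dyadicCube (j + 1) b, (u (y + dyadicPoint (j + 1) (c - b)) - u y)‖ₑ
      ≤ (2 : ℝ≥0∞) ^ (j * k) * ∑ c ∈ dyadicChildren a,
          k * ((2 : ℝ≥0∞) ^ (j + 1))⁻¹ * ∫⁻ z in dyadicCube j a, H z := by
        gcongr
        refine (enorm_sum_le _ _).trans (Finset.sum_le_sum fun c hc => ?_)
        exact (enorm_integral_le_lintegral_enorm _).trans
          (lintegral_enorm_sub_translate_le hH hD (subset_closure.trans hQ) hb hc)
    _ = k * 2 ^ k * ((2 : ℝ≥0∞) ^ (j * k) * ((2 : ℝ≥0∞) ^ (j + 1))⁻¹ *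
          ∫⁻ z in dyadicCube j a, H z) := by
        rw [Finset.sum_const, card_dyadicChildren, nsmul_eq_mul]
        push_cast
        ring
    _ ≤ _ := by
        gcongr
        rw [← div_eq_mul_inv]
        refine ENNReal.div_le_of_le_mul ?_
        rw [← pow_mul, ← pow_add]
        refine pow_le_pow_right₀ (by norm_num) ?_
        obtain ⟨l, rfl⟩ := Nat.exists_eq_add_of_le' hk
        simp only [Nat.add_sub_cancel]
        nlinarith

theorem eventually_closure_dyadicCube_subset {W : Set (Fin k → ℝ)} (hW : IsOpen W)
    {x : Fin k → ℝ} (hx : x ∈ W) :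
    ∀ᶠ j in Filter.atTop, closure (dyadicCube j (dyadicIndex j x)) ⊆ W := by
  obtain ⟨r, hr, hrW⟩ := Metric.nhds_basis_closedBall.mem_iff.1 (hW.mem_nhds hx)
  have h0 : Filter.Tendsto (fun j : ℕ => (1 / 2 : ℝ) ^ j) Filter.atTop (nhds 0) :=
    tendsto_pow_atTop_nhds_zero_of_lt_one (by norm_num) (by norm_num)
  filter_upwards [h0.eventually_lt_const hr] with j hj
  refine (closure_minimal (fun y hy => ?_) Metric.isClosed_closedBall).trans hrW
  exact (dist_le_of_mem_dyadicCube hy (mem_dyadicCube_self j x)).trans hj.le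

theorem tendsto_dyadicAverage [CompleteSpace Y] (hO : IsOpen O) (hu : ContinuousOn u O)
    {x : Fin k → ℝ} (hx : x ∈ O) :
    Filter.Tendsto (fun j => dyadicAverage u j x) Filter.atTop (nhds (u x)) := by
  rw [Metric.tendsto_atTop']
  intro ε hε
  have hcont : ∀ᶠ y in nhds x, dist (u y) (u x) < ε / 2 :=
    Metric.tendsto_nhds.1 (hu.continuousAt (hO.mem_nhds hx)) _ (half_pos hε)
  obtain ⟨W, hWs, hWo, hxW⟩ := _root_.mem_nhds_iff.1 hcont
  obtain ⟨N, hN⟩ := Filter.eventually_atTop.1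
    (eventually_closure_dyadicCube_subset (hWo.inter hO) ⟨hxW, hx⟩)
  refine ⟨N, fun j hj => ?_⟩
  have hQ := hN j hj.le
  have hint := integrableOn_dyadicCube hu (hQ.trans inter_subset_right)
  set Q := dyadicCube j (dyadicIndex j x) with hQdef
  have hvol : volume.real Q = ((2 : ℝ) ^ (j * k))⁻¹ := by
    rw [Measure.real, hQdef, volume_dyadicCube]
    simp
  have hfin : volume Q < ⊤ := by
    rw [hQdef, volume_dyadicCube]
    exact ENNReal.inv_lt_top.2 (by positivity)
  have h2 : (2 : ℝ) ^ (j * k) ≠ 0 := by positivity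
  have heq : dyadicAverage u j x - u x = ((2 : ℝ) ^ (j * k)) • ∫ y in Q, (u y - u x) := by
    rw [integral_sub hint (integrableOn_const hfin.ne), setIntegral_const, hvol, smul_sub,
      smul_smul, mul_inv_cancel₀ h2, one_smul]
    rfl
  have hle : ‖∫ y in Q, (u y - u x)‖ ≤ ε / 2 * volume.real Q := by
    refine norm_setIntegral_le_of_norm_le_const hfin fun y hy => ?_
    rw [← dist_eq_norm]
    exact (hWs (hQ (subset_closure hy)).1).le
  rw [dist_eq_norm, heq, norm_smul, Real.norm_of_nonneg (by positivity)]
  calc (2 : ℝ) ^ (j * k) * ‖∫ y in Q, (u y - u x)‖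
      ≤ (2 : ℝ) ^ (j * k) * (ε / 2 * volume.real Q) := by gcongr
    _ = ε / 2 := by rw [hvol]; field_simp
    _ < ε := half_lt_self hε

/-- Telescoping along the dyadic cubes shrinking to `x`. -/
theorem enorm_dyadicAverage_sub_le_tsum [CompleteSpace Y] (hk : 1 ≤ k) (hO : IsOpen O)
    (hu : ContinuousOn u O) (hH : Measurable H) (hD : IsDyadicGradientBound O u H) (j : ℕ)
    (x : Fin k → ℝ) (hQ : closure (dyadicCube j (dyadicIndex j x)) ⊆ O) :
    ‖dyadicAverage u j x - u x‖ₑ ≤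
      ∑' i : ℕ, k * 2 ^ k * (((2 : ℝ≥0∞) ^ (j + i)) ^ (k - 1) *
        ∫⁻ z in dyadicCube (j + i) (dyadicIndex (j + i) x), H z) := by
  have hx : x ∈ O := hQ (subset_closure (mem_dyadicCube_self j x))
  set T : ℕ → ℝ≥0∞ := fun i => k * 2 ^ k * (((2 : ℝ≥0∞) ^ (j + i)) ^ (k - 1) *
        ∫⁻ z in dyadicCube (j + i) (dyadicIndex (j + i) x), H z) with hT
  have hfin : ∀ N : ℕ, ‖dyadicAverage u j x - dyadicAverage u (j + N) x‖ₑ ≤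
      ∑ i ∈ Finset.range N, T i := by
    intro N
    induction N with
    | zero => simp
    | succ N ih =>
      rw [Finset.sum_range_succ]
      have hstep := enorm_dyadicAverage_sub_succ_le hk hu hH hD (j + N) x
        ((closure_mono (dyadicCube_subset_of_le (Nat.le_add_right j N) x)).trans hQ)
      calc ‖dyadicAverage u j x - dyadicAverage u (j + (N + 1)) x‖ₑ
          = ‖(dyadicAverage u j x - dyadicAverage u (j + N) x) +
              (dyadicAverage u (j + N) x - dyadicAverage u (j + N + 1) x)‖ₑ := by
            rw [sub_add_sub_cancel, add_assoc]
        _ ≤ _ := (enorm_add_le _ _).trans (add_le_add ih hstep)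
  have hlim : Filter.Tendsto (fun N => ‖dyadicAverage u j x - dyadicAverage u (j + N) x‖ₑ)
      Filter.atTop (nhds ‖dyadicAverage u j x - u x‖ₑ) := by
    have h1 := (tendsto_dyadicAverage hO hu hx).comp
      (Filter.tendsto_add_atTop_nat j)
    have h2 : Filter.Tendsto (fun N => dyadicAverage u (j + N) x) Filter.atTop (nhds (u x)) := by
      simpa only [Function.comp_def, add_comm] using h1
    exact (h2.const_sub _).enorm
  exact le_of_tendsto hlim (Filter.Eventually.of_forall fun N =>
    (hfin N).trans (ENNReal.sum_le_tsum _))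

end

/-! ### Decomposition by the size of the gradient -/

/-- The weight `1_{t > 0} + φ(t)`; it dominates `φ`, is bounded below for `t > 0`, and still
vanishes at `t = 0`. -/
noncomputable def orliczWeight (φ : ℝ → ℝ) (t : ℝ) : ℝ≥0∞ :=
  (if 0 < t then 1 else 0) + ENNReal.ofReal (φ t)

/-- The lower ends `0, 1, 2, 4, …` of the ranges `(0, 1], (1, 2], (2, 4], …`. -/
noncomputable def shellBottom : ℕ → ℝ
  | 0 => 0
  | i + 1 => 2 ^ i

/-- The set where `h` takes values in the `i`-th of the ranges `(0, 1], (1, 2], (2, 4], …`. -/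
def shell {X : Type*} (h : X → ℝ) (i : ℕ) : Set X := {x | shellBottom i < h x ∧ h x ≤ 2 ^ i}

/-- The sum `∑ᵢ (2ⁱᵏ / (1 + φ(tᵢ)))^{1/(k-1)}` with `tᵢ` the bottom of the `i`-th shell, a
discretization of `∫ (t / φ(t))^{1/(k-1)} dt`. -/
noncomputable def orliczSum (φ : ℝ → ℝ) (k : ℕ) : ℝ≥0∞ :=
  ∑' i : ℕ, ((2 : ℝ≥0∞) ^ (i * k) / (1 + ENNReal.ofReal (φ (shellBottom i)))) ^
    (1 / ((k : ℝ) - 1))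

theorem shellBottom_nonneg (i : ℕ) : 0 ≤ shellBottom i := by
  cases i <;> simp [shellBottom]

theorem orliczWeight_zero {φ : ℝ → ℝ} (hφ0 : φ 0 = 0) : orliczWeight φ 0 = 0 := by
  simp [orliczWeight, hφ0]

theorem orliczWeight_mono {φ : ℝ → ℝ} (hφ : MonotoneOn φ (Ici 0)) {s t : ℝ} (hs : 0 ≤ s)
    (hst : s ≤ t) : orliczWeight φ s ≤ orliczWeight φ t := by
  unfold orliczWeight
  refine add_le_add ?_ (ENNReal.ofReal_le_ofReal (hφ hs (hs.trans hst) hst))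
  by_cases h : 0 < s
  · rw [if_pos h, if_pos (h.trans_le hst)]
  · rw [if_neg h]
    exact zero_le

theorem measurable_orliczWeight_comp {X : Type*} [MeasurableSpace X] {φ : ℝ → ℝ}
    (hφ : MonotoneOn φ (Ici 0)) {h : X → ℝ} (hm : Measurable h) (h0 : ∀ x, 0 ≤ h x) :
    Measurable fun x => orliczWeight φ (h x) := by
  -- `φ` is only monotone on `[0, ∞)`, so the weight is first replaced by a monotone function on `ℝ`
  have hmono : Monotone fun t => orliczWeight φ (max t 0) := fun s t hst =>
    orliczWeight_mono hφ (le_max_right _ _) (max_le_max_right 0 hst)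
  have heq : (fun x => orliczWeight φ (h x)) = (fun t => orliczWeight φ (max t 0)) ∘ h :=
    funext fun x => by simp only [Function.comp_apply, max_eq_left (h0 x)]
  rw [heq]
  exact hmono.measurable.comp hm

section
variable {X : Type*} {h : X → ℝ}

theorem measurableSet_shell [MeasurableSpace X] (hm : Measurable h) (i : ℕ) :
    MeasurableSet (shell h i) :=
  (measurableSet_lt measurable_const hm).inter (measurableSet_le hm measurable_const)

theorem shell_disjoint {i l : ℕ} (hil : i ≠ l) : Disjoint (shell h i) (shell h l) := by
  wlog hlt : i < l generalizing i l
  · exact (this hil.symm (by omega)).symm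
  refine Set.disjoint_left.2 fun x hx hx' => ?_
  obtain ⟨p, rfl⟩ : ∃ p, l = p + 1 := ⟨l - 1, by omega⟩
  have h1 : (2 : ℝ) ^ i ≤ 2 ^ p := pow_le_pow_right₀ (by norm_num) (by omega)
  have h2 : (2 : ℝ) ^ p < h x := hx'.1
  linarith [hx.2]

theorem exists_mem_shell {x : X} (hx : 0 < h x) : ∃ i, x ∈ shell h i := by
  have hex : ∃ i : ℕ, h x ≤ 2 ^ i := by
    obtain ⟨i, hi⟩ := pow_unbounded_of_one_lt (h x) (by norm_num : (1 : ℝ) < 2)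
    exact ⟨i, hi.le⟩
  classical
  refine ⟨Nat.find hex, ?_, Nat.find_spec hex⟩
  rcases hn : Nat.find hex with _ | p
  · exact hx
  · have := Nat.find_min hex (m := p) (by omega)
    exact not_le.1 this

theorem setLIntegral_le_tsum_shell [MeasurableSpace X] {μ : Measure X} (hm : Measurable h)
    (Q : Set X) :
    ∫⁻ x in Q, ENNReal.ofReal (h x) ∂μ ≤ ∑' i : ℕ, 2 ^ i * μ (shell h i ∩ Q) := by
  calc ∫⁻ x in Q, ENNReal.ofReal (h x) ∂μ
      ≤ ∫⁻ x in Q, ∑' i : ℕ, (shell h i).indicator (fun _ => (2 : ℝ≥0∞) ^ i) x ∂μ := by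
        refine lintegral_mono fun x => ?_
        rcases le_or_gt (h x) 0 with hx | hx
        · rw [ENNReal.ofReal_of_nonpos hx]
          exact zero_le
        · obtain ⟨i, hi⟩ := exists_mem_shell hx
          refine le_trans ?_ (ENNReal.le_tsum i)
          rw [indicator_of_mem hi]
          refine (ENNReal.ofReal_le_ofReal hi.2).trans_eq ?_
          rw [ENNReal.ofReal_pow (by norm_num)]
          norm_num
    _ = ∑' i : ℕ, 2 ^ i * μ (shell h i ∩ Q) := by
        rw [lintegral_tsum fun i =>
          (measurable_const.indicator (measurableSet_shell hm i)).aemeasurable]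
        refine tsum_congr fun i => ?_
        rw [lintegral_indicator_const (measurableSet_shell hm i),
          Measure.restrict_apply (measurableSet_shell hm i)]

theorem tsum_shell_le_setLIntegral [MeasurableSpace X] {μ : Measure X} {φ : ℝ → ℝ}
    (hφ : MonotoneOn φ (Ici 0)) (hm : Measurable h) {Q : Set X} (hQ : MeasurableSet Q) :
    ∑' i : ℕ, (1 + ENNReal.ofReal (φ (shellBottom i))) * μ (shell h i ∩ Q) ≤
      ∫⁻ x in Q, orliczWeight φ (h x) ∂μ := by
  have hmeas : ∀ i, MeasurableSet (shell h i ∩ Q) := fun i => (measurableSet_shell hm i).inter hQ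
  calc ∑' i : ℕ, (1 + ENNReal.ofReal (φ (shellBottom i))) * μ (shell h i ∩ Q)
      ≤ ∑' i : ℕ, ∫⁻ x in shell h i ∩ Q, orliczWeight φ (h x) ∂μ := by
        refine ENNReal.tsum_le_tsum fun i => ?_
        rw [← setLIntegral_const]
        refine setLIntegral_mono' (hmeas i) fun x hx => ?_
        have hpos : 0 < h x := (shellBottom_nonneg i).trans_lt hx.1.1
        rw [orliczWeight, if_pos hpos]
        gcongr
        exact hφ (shellBottom_nonneg i) hpos.le hx.1.1.le
    _ = ∫⁻ x in ⋃ i, shell h i ∩ Q, orliczWeight φ (h x) ∂μ :=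
        (lintegral_iUnion hmeas (fun i l hil =>
          (shell_disjoint hil).mono inter_subset_left inter_subset_left) _).symm
    _ ≤ _ := lintegral_mono_set (iUnion_subset fun i => inter_subset_right)

end

/-- Summing the smaller of two geometric progressions, one increasing and one decreasing, costs only
a constant times the value where they cross. -/
theorem tsum_pow_mul_min_le {k : ℕ} (hk : 2 ≤ k) (e : ℝ≥0∞) :
    ∑' j : ℕ, ((2 : ℝ≥0∞) ^ j) ^ (k - 1) * min e ((2 : ℝ≥0∞) ^ (j * k))⁻¹ ≤
      4 * e ^ (1 / (k : ℝ)) := by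
  obtain ⟨r, rfl⟩ : ∃ r : ℝ≥0∞, e = r ^ k := by
    refine ⟨e ^ (1 / (k : ℝ)), ?_⟩
    rw [← ENNReal.rpow_natCast, ← ENNReal.rpow_mul, one_div_mul_cancel (by positivity),
      ENNReal.rpow_one]
  have hroot : (r ^ k) ^ (1 / (k : ℝ)) = r := by
    rw [← ENNReal.rpow_natCast, ← ENNReal.rpow_mul, mul_one_div_cancel (by positivity),
      ENNReal.rpow_one]
  rw [hroot]
  obtain ⟨l, rfl⟩ := Nat.exists_eq_add_of_le' hk
  obtain ⟨b, hb⟩ : ∃ b : ℕ → ℝ≥0∞, ∀ j, b j =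
      ((2 : ℝ≥0∞) ^ j) ^ (l + 1) * min (r ^ (l + 2)) ((2 : ℝ≥0∞) ^ (j * (l + 2)))⁻¹ :=
    ⟨_, fun _ => rfl⟩
  have hb' : ∑' j : ℕ, ((2 : ℝ≥0∞) ^ j) ^ (l + 2 - 1) *
      min (r ^ (l + 2)) ((2 : ℝ≥0∞) ^ (j * (l + 2)))⁻¹ = ∑' j, b j :=
    tsum_congr fun j => (hb j).symm
  rw [hb']
  have hb2 : ∀ j, b j ≤ ((2 : ℝ≥0∞) ^ j)⁻¹ := by
    intro j
    rw [hb]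
    refine (mul_le_mul' le_rfl (min_le_right _ _)).trans_eq ?_
    have h0 : ((2 : ℝ≥0∞) ^ j) ^ (l + 1) ≠ 0 := pow_ne_zero _ (pow_ne_zero _ two_ne_zero)
    have ht : ((2 : ℝ≥0∞) ^ j) ^ (l + 1) ≠ ⊤ :=
      ENNReal.pow_ne_top (ENNReal.pow_ne_top ENNReal.ofNat_ne_top)
    rw [show j * (l + 2) = j * (l + 1) + j by ring, pow_add 2, pow_mul,
      ENNReal.mul_inv (Or.inl h0) (Or.inl ht), ← mul_assoc, ENNReal.mul_inv_cancel h0 ht, one_mul]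
  have hb1 : ∀ j, (2 : ℝ≥0∞) ^ j * r ≤ 1 → b j ≤ r * r * 2 ^ j := by
    intro j hj
    rw [hb]
    calc _ ≤ ((2 : ℝ≥0∞) ^ j) ^ (l + 1) * r ^ (l + 2) := mul_le_mul' le_rfl (min_le_left _ _)
      _ = (2 ^ j * r) ^ l * (r * r * 2 ^ j) := by ring
      _ ≤ 1 ^ l * (r * r * 2 ^ j) := by gcongr
      _ = _ := by rw [one_pow, one_mul]
  rcases eq_or_ne r 0 with rfl | hr
  · refine (ENNReal.tsum_le_tsum (g := fun _ => 0) fun j => ?_).trans (by simp)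
    exact (hb1 j (by simp)).trans_eq (by simp)
  have hex : ∃ N : ℕ, 1 < (2 : ℝ≥0∞) ^ N * r := by
    obtain ⟨N, hN⟩ := ENNReal.exists_nat_mul_gt hr ENNReal.one_ne_top
    refine ⟨N, hN.trans_le ?_⟩
    gcongr
    exact_mod_cast (Nat.lt_two_pow_self (n := N)).le
  classical
  set N := Nat.find hex with hNdef
  have hN : 1 < (2 : ℝ≥0∞) ^ N * r := Nat.find_spec hex
  have hlow : ∀ j < N, (2 : ℝ≥0∞) ^ j * r ≤ 1 := fun j hj => not_lt.1 (Nat.find_min hex hj)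
  have hgeom : ∀ n : ℕ, ∑ j ∈ Finset.range n, (2 : ℝ≥0∞) ^ j ≤ 2 ^ n := by
    intro n
    induction n with
    | zero => simp
    | succ n ih =>
      rw [Finset.sum_range_succ, pow_succ, mul_two]
      gcongr
  rw [← ENNReal.summable.sum_add_tsum_nat_add' (f := b) (k := N)]
  have h1 : ∑ j ∈ Finset.range N, b j ≤ 2 * r := by
    rcases hn : N with _ | p
    · simp
    · calc ∑ j ∈ Finset.range (p + 1), b j
          ≤ ∑ j ∈ Finset.range (p + 1), r * r * 2 ^ j :=
            Finset.sum_le_sum fun j hj => hb1 j (hlow j (by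
              have := Finset.mem_range.1 hj
              omega))
        _ ≤ r * r * 2 ^ (p + 1) := by
            rw [← Finset.mul_sum]
            gcongr
            exact hgeom _
        _ = 2 * r * (2 ^ p * r) := by ring
        _ ≤ 2 * r * 1 := by
            gcongr
            exact hlow p (by omega)
        _ = 2 * r := mul_one _
  have h2 : ∑' j, b (j + N) ≤ 2 * r := by
    calc ∑' j, b (j + N) ≤ ∑' j : ℕ, ((2 : ℝ≥0∞)⁻¹) ^ j * ((2 : ℝ≥0∞)⁻¹) ^ N := by
          refine ENNReal.tsum_le_tsum fun j => (hb2 _).trans_eq ?_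
          rw [← pow_add, ENNReal.inv_pow]
      _ = 2 * ((2 : ℝ≥0∞) ^ N)⁻¹ := by
          rw [ENNReal.tsum_mul_right, ENNReal.tsum_geometric, ENNReal.one_sub_inv_two, inv_inv,
            ENNReal.inv_pow]
      _ ≤ 2 * r := by
          gcongr
          rw [ENNReal.inv_le_iff_le_mul (by simp) (by simp)]
          exact hN.le
  calc _ ≤ 2 * r + 2 * r := add_le_add h1 h2
    _ = 4 * r := by ring

/-- Hölder's inequality with exponents `k` and `k / (k - 1)`. -/
theorem tsum_two_pow_mul_rpow_le {k : ℕ} (hk : 2 ≤ k) (φ : ℝ → ℝ) (e : ℕ → ℝ≥0∞) :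
    ∑' i : ℕ, 2 ^ i * e i ^ (1 / (k : ℝ)) ≤
      (∑' i : ℕ, (1 + ENNReal.ofReal (φ (shellBottom i))) * e i) ^ (1 / (k : ℝ)) *
        orliczSum φ k ^ (((k : ℝ) - 1) / k) := by
  have hk0 : (0 : ℝ) < k := by positivity
  have hk1 : (1 : ℝ) < k := by exact_mod_cast hk
  have hk1' : (k : ℝ) - 1 ≠ 0 := by linarith
  set a : ℕ → ℝ≥0∞ := fun i => 1 + ENNReal.ofReal (φ (shellBottom i)) with ha
  have ha0 : ∀ i, a i ≠ 0 := fun i => by simp [ha]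
  have hat : ∀ i, a i ≠ ⊤ := fun i => by simp [ha]
  set F : ℕ → ℝ≥0∞ := fun i => (a i * e i) ^ (1 / (k : ℝ)) with hF
  set G : ℕ → ℝ≥0∞ := fun i => ((2 : ℝ≥0∞) ^ (i * k) / a i) ^ (1 / (k : ℝ)) with hG
  have hpq : (k : ℝ).HolderConjugate (k / (k - 1)) := by
    rw [Real.holderConjugate_iff]
    refine ⟨hk1, ?_⟩
    field_simp
    ring
  have hol := ENNReal.lintegral_mul_le_Lp_mul_Lq (μ := Measure.count) hpq
    (f := F) (g := G) (measurable_of_countable _).aemeasurable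
    (measurable_of_countable _).aemeasurable
  simp only [lintegral_count, Pi.mul_apply] at hol
  convert hol using 2
  · funext i
    simp only [hF, hG]
    rw [← ENNReal.mul_rpow_of_nonneg _ _ (by positivity), mul_right_comm,
      ENNReal.mul_div_cancel (ha0 i) (hat i), ENNReal.mul_rpow_of_nonneg _ _ (by positivity),
      pow_mul, ← ENNReal.rpow_natCast (2 ^ i), ← ENNReal.rpow_mul, mul_one_div_cancel hk0.ne',
      ENNReal.rpow_one]
  · congr 1
    refine tsum_congr fun i => ?_
    simp only [hF]
    rw [← ENNReal.rpow_mul, one_div_mul_cancel hk0.ne', ENNReal.rpow_one]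
  · rw [orliczSum]
    congr 1
    · refine tsum_congr fun i => ?_
      simp only [hG]
      rw [← ENNReal.rpow_mul]
      congr 1
      field_simp
    · field_simp

/-- The integral condition on `φ` implies that its dyadic discretization is finite. -/
theorem orliczSum_lt_top {k : ℕ} (hk : 2 ≤ k) {φ : ℝ → ℝ} (hφ : MonotoneOn φ (Ici 0))
    (hint : ∫⁻ t in Ioi (1 : ℝ),
      (ENNReal.ofReal t / ENNReal.ofReal (φ t)) ^ (1 / ((k : ℝ) - 1)) < ⊤) :
    orliczSum φ k < ⊤ := by
  have hk1 : (1 : ℝ) < k := by exact_mod_cast hk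
  set β : ℝ := 1 / ((k : ℝ) - 1) with hβ
  have hβ0 : 0 < β := one_div_pos.2 (sub_pos.2 hk1)
  set T : ℕ → ℝ≥0∞ := fun i =>
    ((2 : ℝ≥0∞) ^ (i * k) / (1 + ENNReal.ofReal (φ (shellBottom i)))) ^ β with hT
  have hT0 : ∀ i, T i ≠ ⊤ := fun i => by
    refine ENNReal.rpow_ne_top_of_nonneg hβ0.le (ENNReal.div_ne_top ?_ ?_)
    · exact ENNReal.pow_ne_top ENNReal.ofNat_ne_top
    · simp
  set I : ℕ → Set ℝ := fun p => Ioc ((2 : ℝ) ^ p) (2 ^ (p + 1)) with hI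
  have hmono : Monotone fun p : ℕ => (2 : ℝ) ^ p := fun a b hab =>
    pow_le_pow_right₀ (by norm_num) hab
  have hvol : ∀ p, volume (I p) = 2 ^ p := by
    intro p
    rw [hI, Real.volume_Ioc, pow_succ, mul_two, add_sub_cancel_right,
      ENNReal.ofReal_pow (by norm_num)]
    norm_num
  have hstep : ∀ p, T (p + 2) ≤ ((2 : ℝ≥0∞) ^ (2 * k)) ^ β *
      ∫⁻ t in I p, (ENNReal.ofReal t / ENNReal.ofReal (φ t)) ^ β := by
    intro p
    set Φ := ENNReal.ofReal (φ (2 ^ (p + 1))) with hΦ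
    have hlow : 2 ^ p * ((2 : ℝ≥0∞) ^ p / Φ) ^ β ≤
        ∫⁻ t in I p, (ENNReal.ofReal t / ENNReal.ofReal (φ t)) ^ β := by
      rw [← hvol p, mul_comm, ← setLIntegral_const]
      refine setLIntegral_mono' measurableSet_Ioc fun t ht => ?_
      have h2p : (0 : ℝ) < 2 ^ p := by positivity
      gcongr
      · rw [hvol, ← ENNReal.ofReal_ofNat, ← ENNReal.ofReal_pow (by norm_num)]
        exact ENNReal.ofReal_le_ofReal ht.1.le
      · exact ENNReal.ofReal_le_ofReal
          (hφ (h2p.trans ht.1).le (h2p.trans (ht.1.trans_le ht.2)).le ht.2)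
    refine le_trans ?_ (mul_le_mul' le_rfl hlow)
    have hpow : ((2 : ℝ≥0∞) ^ (p * (k - 1))) ^ β = 2 ^ p := by
      rw [pow_mul, ← ENNReal.rpow_natCast (2 ^ p), ← ENNReal.rpow_mul,
        Nat.cast_sub (by omega : 1 ≤ k), Nat.cast_one, hβ,
        mul_one_div_cancel (sub_pos.2 hk1).ne', ENNReal.rpow_one]
    refine le_trans ?_ (mul_le_mul' le_rfl (mul_le_mul' hpow.le le_rfl))
    rw [← ENNReal.mul_rpow_of_nonneg _ _ hβ0.le, ← ENNReal.mul_rpow_of_nonneg _ _ hβ0.le]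
    refine ENNReal.rpow_le_rpow ?_ hβ0.le
    calc (2 : ℝ≥0∞) ^ ((p + 2) * k) / (1 + ENNReal.ofReal (φ (shellBottom (p + 2))))
        ≤ (2 : ℝ≥0∞) ^ ((p + 2) * k) / Φ := by
          gcongr
          exact le_add_self
      _ = (2 : ℝ≥0∞) ^ (2 * k) * ((2 : ℝ≥0∞) ^ (p * (k - 1)) * ((2 : ℝ≥0∞) ^ p / Φ)) := by
          rw [← mul_div_assoc, ← mul_div_assoc, ← pow_add, ← pow_add]
          congr 2
          obtain ⟨l, rfl⟩ := Nat.exists_eq_add_of_le' (by omega : 1 ≤ k)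
          simp only [Nat.add_sub_cancel]
          ring
  have hsum : ∑' p, T (p + 2) < ⊤ := by
    refine (ENNReal.tsum_le_tsum hstep).trans_lt ?_
    rw [ENNReal.tsum_mul_left]
    refine ENNReal.mul_lt_top ?_ ?_
    · exact (ENNReal.rpow_ne_top_of_nonneg hβ0.le
        (ENNReal.pow_ne_top ENNReal.ofNat_ne_top)).lt_top
    · rw [← lintegral_iUnion (s := I) (fun p => measurableSet_Ioc)
        hmono.pairwise_disjoint_on_Ioc_succ]
      refine (lintegral_mono_set (iUnion_subset fun p t ht => ?_)).trans_lt hint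
      exact (one_le_pow₀ (by norm_num : (1 : ℝ) ≤ 2)).trans_lt ht.1
  change ∑' i, T i < ⊤
  rw [← ENNReal.summable.sum_add_tsum_nat_add' (f := T) (k := 2)]
  exact ENNReal.add_lt_top.2 ⟨(ENNReal.sum_ne_top.2 fun i _ => hT0 i).lt_top, hsum⟩

/-! ### Oscillation on a dyadic cube -/

/-- The constant in the oscillation estimate `ediam_image_dyadicCube_pow_le`. -/
noncomputable def oscConst (φ : ℝ → ℝ) (k : ℕ) : ℝ≥0∞ :=
  (2 * (k * 2 ^ k * (4 * orliczSum φ k ^ (((k : ℝ) - 1) / k)))) ^ k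

theorem oscConst_lt_top {φ : ℝ → ℝ} {k : ℕ} (hk : 2 ≤ k) (h : orliczSum φ k < ⊤) :
    oscConst φ k < ⊤ := by
  have hk1 : (1 : ℝ) < k := by exact_mod_cast hk
  have : orliczSum φ k ^ (((k : ℝ) - 1) / k) ≠ ⊤ :=
    ENNReal.rpow_ne_top_of_nonneg (div_nonneg (by linarith) (by linarith)) h.ne
  unfold oscConst
  finiteness

section
variable {k : ℕ} {Y : Type*} [NormedAddCommGroup Y] [NormedSpace ℝ Y] [CompleteSpace Y]
  {O : Set (Fin k → ℝ)} {u : (Fin k → ℝ) → Y} {h : (Fin k → ℝ) → ℝ} {φ : ℝ → ℝ}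

/-- Each shell of `h` contributes to the telescoping sum at most a constant times its height times
the `k`-th root of its measure; Hölder's inequality adds up these contributions. -/
theorem enorm_dyadicAverage_sub_le (hk : 2 ≤ k) (hφ : MonotoneOn φ (Ici 0)) (hO : IsOpen O)
    (hu : ContinuousOn u O) (hm : Measurable h)
    (hD : IsDyadicGradientBound O u fun x => ENNReal.ofReal (h x)) (j : ℕ) (x : Fin k → ℝ)
    (hQ : closure (dyadicCube j (dyadicIndex j x)) ⊆ O) :
    ‖dyadicAverage u j x - u x‖ₑ ≤ k * 2 ^ k * (4 * orliczSum φ k ^ (((k : ℝ) - 1) / k)) *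
      (∫⁻ z in dyadicCube j (dyadicIndex j x), orliczWeight φ (h z)) ^ (1 / (k : ℝ)) := by
  set Q := dyadicCube j (dyadicIndex j x) with hQdef
  set e : ℕ → ℝ≥0∞ := fun l => volume (shell h l ∩ Q) with he
  refine (enorm_dyadicAverage_sub_le_tsum (by omega) hO hu hm.ennreal_ofReal hD j x hQ).trans ?_
  rw [ENNReal.tsum_mul_left, mul_assoc (k * 2 ^ k : ℝ≥0∞)]
  refine mul_le_mul' le_rfl ?_
  have hterm : ∀ i l : ℕ, volume (shell h l ∩ dyadicCube (j + i) (dyadicIndex (j + i) x)) ≤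
      min (e l) ((2 : ℝ≥0∞) ^ ((j + i) * k))⁻¹ := by
    intro i l
    refine le_min (measure_mono (inter_subset_inter_right _
      (dyadicCube_subset_of_le (Nat.le_add_right j i) x))) ?_
    rw [← volume_dyadicCube (j + i) (dyadicIndex (j + i) x)]
    exact measure_mono inter_subset_right
  calc ∑' i : ℕ, ((2 : ℝ≥0∞) ^ (j + i)) ^ (k - 1) *
        ∫⁻ z in dyadicCube (j + i) (dyadicIndex (j + i) x), ENNReal.ofReal (h z)
      ≤ ∑' i : ℕ, ∑' l : ℕ, 2 ^ l * (((2 : ℝ≥0∞) ^ (j + i)) ^ (k - 1) *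
          min (e l) ((2 : ℝ≥0∞) ^ ((j + i) * k))⁻¹) := by
        refine ENNReal.tsum_le_tsum fun i => ?_
        refine (mul_le_mul' le_rfl (setLIntegral_le_tsum_shell hm _)).trans ?_
        rw [← ENNReal.tsum_mul_left]
        refine ENNReal.tsum_le_tsum fun l => ?_
        rw [mul_left_comm]
        exact mul_le_mul' le_rfl (mul_le_mul' le_rfl (hterm i l))
    _ = ∑' l : ℕ, 2 ^ l * ∑' i : ℕ, (((2 : ℝ≥0∞) ^ (j + i)) ^ (k - 1) *
          min (e l) ((2 : ℝ≥0∞) ^ ((j + i) * k))⁻¹) := by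
        rw [ENNReal.tsum_comm]
        exact tsum_congr fun l => ENNReal.tsum_mul_left
    _ ≤ ∑' l : ℕ, 2 ^ l * (4 * e l ^ (1 / (k : ℝ))) := by
        refine ENNReal.tsum_le_tsum fun l => mul_le_mul' le_rfl ?_
        refine le_trans ?_ (tsum_pow_mul_min_le hk (e l))
        exact ENNReal.tsum_comp_le_tsum_of_injective (add_right_injective j)
          fun i => ((2 : ℝ≥0∞) ^ i) ^ (k - 1) * min (e l) ((2 : ℝ≥0∞) ^ (i * k))⁻¹
    _ = 4 * ∑' l : ℕ, 2 ^ l * e l ^ (1 / (k : ℝ)) := by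
        rw [← ENNReal.tsum_mul_left]
        exact tsum_congr fun l => mul_left_comm _ _ _
    _ ≤ 4 * ((∫⁻ z in Q, orliczWeight φ (h z)) ^ (1 / (k : ℝ)) *
          orliczSum φ k ^ (((k : ℝ) - 1) / k)) := by
        refine mul_le_mul' le_rfl ((tsum_two_pow_mul_rpow_le hk φ e).trans ?_)
        gcongr
        exact tsum_shell_le_setLIntegral hφ hm (measurableSet_dyadicCube _ _)
    _ = _ := by ring

/-- The oscillation estimate: the `k`-th power of the diameter of the image of a dyadic cube is
controlled by the integral over that cube of the weight of the gradient. -/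
theorem ediam_image_dyadicCube_pow_le (hk : 2 ≤ k) (hφ : MonotoneOn φ (Ici 0)) (hO : IsOpen O)
    (hu : ContinuousOn u O) (hm : Measurable h)
    (hD : IsDyadicGradientBound O u fun x => ENNReal.ofReal (h x)) (j : ℕ) (a : Fin k → ℤ)
    (hQ : closure (dyadicCube j a) ⊆ O) :
    Metric.ediam (u '' dyadicCube j a) ^ k ≤
      oscConst φ k * ∫⁻ z in dyadicCube j a, orliczWeight φ (h z) := by
  set C : ℝ≥0∞ := k * 2 ^ k * (4 * orliczSum φ k ^ (((k : ℝ) - 1) / k)) with hC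
  set I := ∫⁻ z in dyadicCube j a, orliczWeight φ (h z) with hI
  have hdiam : Metric.ediam (u '' dyadicCube j a) ≤ 2 * C * I ^ (1 / (k : ℝ)) := by
    refine Metric.ediam_le ?_
    rintro _ ⟨x, hx, rfl⟩ _ ⟨y, hy, rfl⟩
    have hest : ∀ z ∈ dyadicCube j a,
        ‖((2 : ℝ) ^ (j * k)) • (∫ y in dyadicCube j a, u y) - u z‖ₑ ≤ C * I ^ (1 / (k : ℝ)) := by
      rintro z rfl
      exact enorm_dyadicAverage_sub_le hk hφ hO hu hm hD j z hQ
    have h1 := hest x hx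
    have h2 := hest y hy
    rw [← edist_eq_enorm_sub] at h1 h2
    calc edist (u x) (u y) ≤ _ + _ := edist_triangle_left _ _ _
      _ ≤ C * I ^ (1 / (k : ℝ)) + C * I ^ (1 / (k : ℝ)) := add_le_add h1 h2
      _ = 2 * C * I ^ (1 / (k : ℝ)) := by ring
  calc Metric.ediam (u '' dyadicCube j a) ^ k ≤ (2 * C * I ^ (1 / (k : ℝ))) ^ k := by gcongr
    _ = oscConst φ k * I := by
        rw [mul_pow, ← ENNReal.rpow_natCast (I ^ _), ← ENNReal.rpow_mul,
          one_div_mul_cancel (by positivity), ENNReal.rpow_one]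
        rfl

end

/-! ### Covering by maximal dyadic cubes -/

/-- The level of the largest dyadic cube that contains `x`, has side at most `2⁻ᴶ` and whose closure
lies in `W` (the junk value `0` if there is none). -/
noncomputable def whitneyLevel {k : ℕ} (W : Set (Fin k → ℝ)) (J : ℕ) (x : Fin k → ℝ) : ℕ :=
  sInf {j | J ≤ j ∧ closure (dyadicCube j (dyadicIndex j x)) ⊆ W}

section
variable {k : ℕ} {W : Set (Fin k → ℝ)}

theorem whitneyLevel_spec (hW : IsOpen W) (J : ℕ) {x : Fin k → ℝ} (hx : x ∈ W) :
    J ≤ whitneyLevel W J x ∧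
      closure (dyadicCube (whitneyLevel W J x) (dyadicIndex (whitneyLevel W J x) x)) ⊆ W := by
  refine Nat.sInf_mem (s := {j | J ≤ j ∧ closure (dyadicCube j (dyadicIndex j x)) ⊆ W}) ?_
  obtain ⟨j, hj, hJ⟩ := ((eventually_closure_dyadicCube_subset hW hx).and
    (Filter.eventually_ge_atTop J)).exists
  exact ⟨j, hJ, hj⟩

theorem whitneyLevel_le {J j : ℕ} {x : Fin k → ℝ} (hJ : J ≤ j)
    (hj : closure (dyadicCube j (dyadicIndex j x)) ⊆ W) : whitneyLevel W J x ≤ j :=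
  Nat.sInf_le ⟨hJ, hj⟩

theorem whitneyLevel_eq_of_mem (hW : IsOpen W) (J : ℕ) {x y : Fin k → ℝ} (hx : x ∈ W)
    (hxy : dyadicIndex (whitneyLevel W J x) y = dyadicIndex (whitneyLevel W J x) x) :
    whitneyLevel W J y = whitneyLevel W J x := by
  obtain ⟨hJ, hcx⟩ := whitneyLevel_spec hW J hx
  have hle : whitneyLevel W J y ≤ whitneyLevel W J x := whitneyLevel_le hJ (by rwa [hxy])
  have hy : y ∈ W := hcx (subset_closure hxy)
  obtain ⟨hJ', hcy⟩ := whitneyLevel_spec hW J hy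
  refine le_antisymm hle (whitneyLevel_le hJ' ?_)
  rwa [← dyadicIndex_eq_of_le hle hxy]

/-- An open set is the disjoint union of its maximal dyadic cubes of side at most `2⁻ᴶ`. -/
theorem exists_dyadic_partition (hW : IsOpen W) (J : ℕ) :
    ∃ S : Set (ℕ × (Fin k → ℤ)),
      (∀ p ∈ S, J ≤ p.1 ∧ closure (dyadicCube p.1 p.2) ⊆ W) ∧
      (S.PairwiseDisjoint fun p => dyadicCube p.1 p.2) ∧
      W ⊆ ⋃ p : S, dyadicCube p.1.1 p.1.2 := by
  refine ⟨(fun x => (whitneyLevel W J x, dyadicIndex (whitneyLevel W J x) x)) '' W, ?_, ?_, ?_⟩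
  · rintro _ ⟨x, hx, rfl⟩
    exact whitneyLevel_spec hW J hx
  · rintro _ ⟨x, hx, rfl⟩ _ ⟨y, hy, rfl⟩ hne
    refine Set.disjoint_left.2 fun z hzx hzy => hne ?_
    have h1 := whitneyLevel_eq_of_mem hW J hx hzx
    have h2 := whitneyLevel_eq_of_mem hW J hy hzy
    have hzx' : dyadicIndex (whitneyLevel W J x) z = dyadicIndex (whitneyLevel W J x) x := hzx
    have hzy' : dyadicIndex (whitneyLevel W J y) z = dyadicIndex (whitneyLevel W J y) y := hzy
    dsimp only
    rw [← hzx', ← hzy', ← h1, ← h2]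
  · intro x hx
    exact mem_iUnion.2 ⟨⟨_, x, hx, rfl⟩, rfl⟩

end

/-- The image of an open set has Hausdorff measure at most a constant times the integral of the
weight of the gradient. -/
theorem hausdorffMeasure_image_le {k : ℕ} {Y : Type*} [NormedAddCommGroup Y] [NormedSpace ℝ Y]
    [CompleteSpace Y] [MeasurableSpace Y] [BorelSpace Y]
    {O : Set (Fin k → ℝ)} {u : (Fin k → ℝ) → Y} {h : (Fin k → ℝ) → ℝ} {φ : ℝ → ℝ}
    (hk : 2 ≤ k) (hφ : MonotoneOn φ (Ici 0)) (hA : orliczSum φ k < ⊤) (hO : IsOpen O)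
    (hu : ContinuousOn u O) (hm : Measurable h)
    (hD : IsDyadicGradientBound O u fun x => ENNReal.ofReal (h x)) {W : Set (Fin k → ℝ)}
    (hW : IsOpen W) (hWO : W ⊆ O) (hfin : ∫⁻ z in W, orliczWeight φ (h z) ≠ ⊤) :
    Measure.hausdorffMeasure k (u '' W) ≤ oscConst φ k * ∫⁻ z in W, orliczWeight φ (h z) := by
  have hM := oscConst_lt_top hk hA
  set M := oscConst φ k
  choose S hS hSd hSc using fun J => exists_dyadic_partition hW J
  -- the diameters of the images tend to zero uniformly, since so do the volumes of the cubes
  have hsmall : ∀ n : ℕ, ∃ J : ℕ, ∀ p ∈ S J,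
      Metric.ediam (u '' dyadicCube p.1 p.2) ≤ ((2 : ℝ≥0∞)⁻¹) ^ n := by
    intro n
    obtain ⟨ε, hε0, hε⟩ : ∃ ε : ℝ≥0∞, ε ≠ 0 ∧ M * ε ≤ (((2 : ℝ≥0∞)⁻¹) ^ n) ^ k := by
      refine ⟨(((2 : ℝ≥0∞)⁻¹) ^ n) ^ k / M, ?_, ENNReal.mul_div_le⟩
      exact (ENNReal.div_pos (pow_ne_zero _ (pow_ne_zero _
        (ENNReal.inv_ne_zero.2 ENNReal.ofNat_ne_top))) hM.ne).ne'
    obtain ⟨δ, hδ0, hδ⟩ := exists_pos_setLIntegral_lt_of_measure_lt hfin hε0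
    obtain ⟨J, hJ⟩ := ENNReal.exists_inv_two_pow_lt hδ0.ne'
    refine ⟨J, fun p hp => ?_⟩
    obtain ⟨hJp, hpW⟩ := hS J p hp
    have hpW' : dyadicCube p.1 p.2 ⊆ W := subset_closure.trans hpW
    have hvol : volume.restrict W (dyadicCube p.1 p.2) < δ := by
      rw [Measure.restrict_apply (measurableSet_dyadicCube _ _), inter_eq_left.2 hpW',
        volume_dyadicCube]
      refine lt_of_le_of_lt ?_ hJ
      rw [ENNReal.inv_pow]
      exact pow_le_pow_right_of_le_one' (by simp) (hJp.trans (Nat.le_mul_of_pos_right _ (by omega)))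
    have hlt := hδ _ hvol
    rw [Measure.restrict_restrict (measurableSet_dyadicCube _ _), inter_eq_left.2 hpW'] at hlt
    have hpow := (ediam_image_dyadicCube_pow_le hk hφ hO hu hm hD p.1 p.2 (hpW.trans hWO)).trans
      ((mul_le_mul' le_rfl hlt.le).trans hε)
    exact (ENNReal.pow_le_pow_left_iff (by omega)).1 hpow
  choose J hJ using hsmall
  have hlim := Measure.hausdorffMeasure_le_liminf_tsum (k : ℝ) (u '' W) (l := Filter.atTop)
    (fun n : ℕ => ((2 : ℝ≥0∞)⁻¹) ^ n)
    (ENNReal.tendsto_pow_atTop_nhds_zero_of_lt_one ENNReal.one_half_lt_one)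
    (fun n (p : S (J n)) => u '' dyadicCube p.1.1 p.1.2)
    (Filter.Eventually.of_forall fun n p => hJ n p.1 p.2)
    (Filter.Eventually.of_forall fun n => by
      rw [← image_iUnion]
      exact image_mono (hSc (J n)))
  refine hlim.trans (Filter.liminf_le_of_frequently_le' (Filter.Frequently.of_forall fun n => ?_))
  calc ∑' p : S (J n), Metric.ediam (u '' dyadicCube p.1.1 p.1.2) ^ (k : ℝ)
      ≤ ∑' p : S (J n), M * ∫⁻ z in dyadicCube p.1.1 p.1.2, orliczWeight φ (h z) := by
        refine ENNReal.tsum_le_tsum fun p => ?_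
        rw [ENNReal.rpow_natCast]
        exact ediam_image_dyadicCube_pow_le hk hφ hO hu hm hD _ _ ((hS (J n) p.1 p.2).2.trans hWO)
    _ = M * ∫⁻ z in ⋃ p : S (J n), dyadicCube p.1.1 p.1.2, orliczWeight φ (h z) := by
        have hdisj : Pairwise fun p q : S (J n) =>
            Disjoint (dyadicCube p.1.1 p.1.2) (dyadicCube q.1.1 q.1.2) :=
          fun p q hpq => hSd (J n) p.2 q.2 fun h => hpq (Subtype.ext h)
        rw [ENNReal.tsum_mul_left,
          lintegral_iUnion (fun p : S (J n) => measurableSet_dyadicCube p.1.1 p.1.2) hdisj]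
    _ ≤ M * ∫⁻ z in W, orliczWeight φ (h z) := by
        gcongr
        exact iUnion_subset fun p => subset_closure.trans (hS (J n) p.1 p.2).2

/-! ### Absolute continuity and critical sets on a slice -/

/-- An open set has a countable compact exhaustion that absorbs all its compact subsets. -/
theorem exists_nat_isCompact_exhaustion {X : Type*} [TopologicalSpace X] [LocallyCompactSpace X]
    [SecondCountableTopology X] {O : Set X} (hO : IsOpen O) :
    ∃ K : ℕ → Set X, (∀ i, IsCompact (K i)) ∧ (∀ i, K i ⊆ O) ∧
      ∀ L ⊆ O, IsCompact L → ∃ i, L ⊆ K i := by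
  have : LocallyCompactSpace O := hO.locallyCompactSpace
  have hσ : SigmaCompactSpace O := sigmaCompactSpace_of_locallyCompact_secondCountable
  set K := CompactExhaustion.choice O
  refine ⟨fun i => Subtype.val '' K i, fun i => (K.isCompact i).image continuous_subtype_val,
    fun i => ?_, fun L hLO hL => ?_⟩
  · rintro _ ⟨x, -, rfl⟩
    exact x.2
  · have hL' : IsCompact (Subtype.val ⁻¹' L : Set O) :=
      Topology.IsInducing.subtypeVal.isCompact_preimage' hL (by simpa using hLO)
    obtain ⟨i, hi⟩ := K.exists_superset_of_isCompact hL'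
    refine ⟨i, fun x hx => ⟨⟨x, hLO hx⟩, hi hx, rfl⟩⟩

theorem hausdorffMeasure_image_eq_zero_of_forall_isCompact {X Y : Type*} [TopologicalSpace X]
    [LocallyCompactSpace X] [SecondCountableTopology X] [EMetricSpace Y] [MeasurableSpace Y]
    [BorelSpace Y] {u : X → Y} {d : ℝ} {O E : Set X} (hO : IsOpen O) (hEO : E ⊆ O)
    (hE : ∀ K ⊆ O, IsCompact K → Measure.hausdorffMeasure d (u '' (K ∩ E)) = 0) :
    Measure.hausdorffMeasure d (u '' E) = 0 := by
  obtain ⟨K, hKc, hKO, hK⟩ := exists_nat_isCompact_exhaustion hO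
  have hsub : u '' E ⊆ ⋃ i, u '' (K i ∩ E) := by
    rintro _ ⟨x, hx, rfl⟩
    obtain ⟨i, hi⟩ := hK {x} (singleton_subset_iff.2 (hEO hx)) isCompact_singleton
    exact mem_iUnion.2 ⟨i, x, ⟨hi rfl, hx⟩, rfl⟩
  exact measure_mono_null hsub (measure_iUnion_null fun i => hE _ (hKO i) (hKc i))

section
variable {k : ℕ} {Y : Type*} [NormedAddCommGroup Y] [NormedSpace ℝ Y]
  [CompleteSpace Y] [MeasurableSpace Y] [BorelSpace Y]
  {O : Set (Fin k → ℝ)} {u : (Fin k → ℝ) → Y} {h : (Fin k → ℝ) → ℝ} {φ : ℝ → ℝ}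

/-- A set of small measure lies in an open set of small measure, over which the integral of the
weight is small. -/
theorem exists_forall_hausdorffMeasure_image_lt (hk : 2 ≤ k) (hφ : MonotoneOn φ (Ici 0))
    (hA : orliczSum φ k < ⊤) (hO : IsOpen O) (hu : ContinuousOn u O) (hm : Measurable h)
    (hD : IsDyadicGradientBound O u fun x => ENNReal.ofReal (h x))
    (hloc : ∀ K ⊆ O, IsCompact K → ∫⁻ z in K, orliczWeight φ (h z) < ⊤)
    {K : Set (Fin k → ℝ)} (hKO : K ⊆ O) (hK : IsCompact K) {ε : ℝ≥0∞} (hε : 0 < ε) :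
    ∃ δ : ℝ≥0∞, 0 < δ ∧ ∀ E ⊆ K, volume E < δ → Measure.hausdorffMeasure k (u '' E) < ε := by
  obtain ⟨K', hK', hKK', hK'O⟩ := exists_compact_between hK hO hKO
  obtain ⟨c, hc0, hc⟩ := ENNReal.exists_nnreal_pos_mul_lt (oscConst_lt_top hk hA).ne hε.ne'
  obtain ⟨δ, hδ0, hδ⟩ := exists_pos_setLIntegral_lt_of_measure_lt (hloc K' hK'O hK').ne
    (ENNReal.coe_pos.2 hc0).ne'
  refine ⟨δ, hδ0, fun E hEK hEδ => ?_⟩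
  obtain ⟨V, hEV, hVo, hVδ⟩ := Set.exists_isOpen_lt_of_lt E δ hEδ
  set W := V ∩ interior K' with hW
  have hWK' : W ⊆ K' := inter_subset_right.trans interior_subset
  have hWo : IsOpen W := hVo.inter isOpen_interior
  have hlt := hδ W (((Measure.restrict_apply_le K' W).trans
    (measure_mono inter_subset_left)).trans_lt hVδ)
  rw [Measure.restrict_restrict hWo.measurableSet, inter_eq_left.2 hWK'] at hlt
  calc Measure.hausdorffMeasure k (u '' E) ≤ Measure.hausdorffMeasure k (u '' W) :=
        measure_mono (image_mono (subset_inter hEV (hEK.trans hKK')))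
    _ ≤ oscConst φ k * ∫⁻ z in W, orliczWeight φ (h z) :=
        hausdorffMeasure_image_le hk hφ hA hO hu hm hD hWo (hWK'.trans hK'O) hlt.ne_top
    _ ≤ c * oscConst φ k := by
        rw [mul_comm]
        gcongr
    _ < ε := hc

/-- As the weight vanishes where `h` does, open neighbourhoods of the zero set of `h` can be chosen
to carry arbitrarily little of its integral. -/
theorem hausdorffMeasure_image_eq_zero_of_isCompact (hk : 2 ≤ k) (hφ : MonotoneOn φ (Ici 0))
    (hφ0 : φ 0 = 0)
    (hA : orliczSum φ k < ⊤) (hO : IsOpen O) (hu : ContinuousOn u O) (hm : Measurable h)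
    (hD : IsDyadicGradientBound O u fun x => ENNReal.ofReal (h x))
    (hloc : ∀ K ⊆ O, IsCompact K → ∫⁻ z in K, orliczWeight φ (h z) < ⊤)
    {K : Set (Fin k → ℝ)} (hKO : K ⊆ O) (hK : IsCompact K) :
    Measure.hausdorffMeasure k (u '' (K ∩ {x | h x = 0})) = 0 := by
  refine le_antisymm (le_of_forall_pos_le_add fun ε hε => ?_) zero_le
  rw [zero_add]
  obtain ⟨K', hK', hKK', hK'O⟩ := exists_compact_between hK hO hKO
  obtain ⟨c, hc0, hc⟩ := ENNReal.exists_nnreal_pos_mul_lt (oscConst_lt_top hk hA).ne hε.ne'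
  obtain ⟨δ, hδ0, hδ⟩ := exists_pos_setLIntegral_lt_of_measure_lt (hloc K' hK'O hK').ne
    (ENNReal.coe_pos.2 hc0).ne'
  set Z := K ∩ {x | h x = 0} with hZ
  have hZm : MeasurableSet Z := hK.measurableSet.inter (hm (measurableSet_singleton 0))
  have hZfin : volume Z ≠ ⊤ := ((measure_mono inter_subset_left).trans_lt hK.measure_lt_top).ne
  obtain ⟨V, hZV, hVo, -, hVδ⟩ := hZm.exists_isOpen_sdiff_lt hZfin hδ0.ne'
  set W := V ∩ interior K' with hW
  have hWK' : W ⊆ K' := inter_subset_right.trans interior_subset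
  have hWo : IsOpen W := hVo.inter isOpen_interior
  have hlt := hδ (W \ Z) (((Measure.restrict_apply_le K' _).trans
    (measure_mono (sdiff_subset_sdiff_left inter_subset_left))).trans_lt hVδ)
  rw [Measure.restrict_restrict (hWo.measurableSet.diff hZm),
    inter_eq_left.2 (sdiff_subset.trans hWK')] at hlt
  have hzero : ∫⁻ z in W, orliczWeight φ (h z) = ∫⁻ z in W \ Z, orliczWeight φ (h z) := by
    rw [← lintegral_inter_add_sdiff _ W hZm, setLIntegral_congr_fun (hWo.measurableSet.inter hZm)
      (g := fun _ => 0), lintegral_zero, zero_add]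
    intro z hz
    have hz0 : h z = 0 := hz.2.2
    simp only [hz0, orliczWeight_zero hφ0]
  calc Measure.hausdorffMeasure k (u '' Z) ≤ Measure.hausdorffMeasure k (u '' W) :=
        measure_mono (image_mono (subset_inter hZV (inter_subset_left.trans hKK')))
    _ ≤ oscConst φ k * ∫⁻ z in W, orliczWeight φ (h z) :=
        hausdorffMeasure_image_le hk hφ hA hO hu hm hD hWo (hWK'.trans hK'O)
          (hzero ▸ hlt.ne_top)
    _ ≤ c * oscConst φ k := by
        rw [mul_comm, hzero]
        gcongr
    _ ≤ ε := hc.le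

theorem hausdorffMeasure_image_eq_zero_of_volume_eq_zero (hk : 2 ≤ k) (hφ : MonotoneOn φ (Ici 0))
    (hA : orliczSum φ k < ⊤) (hO : IsOpen O) (hu : ContinuousOn u O) (hm : Measurable h)
    (hD : IsDyadicGradientBound O u fun x => ENNReal.ofReal (h x))
    (hloc : ∀ K ⊆ O, IsCompact K → ∫⁻ z in K, orliczWeight φ (h z) < ⊤)
    {E : Set (Fin k → ℝ)} (hEO : E ⊆ O) (hE : volume E = 0) :
    Measure.hausdorffMeasure k (u '' E) = 0 := by
  refine hausdorffMeasure_image_eq_zero_of_forall_isCompact hO hEO fun K hKO hK => ?_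
  refine le_antisymm (le_of_forall_pos_le_add fun ε hε => ?_) zero_le
  rw [zero_add]
  obtain ⟨δ, hδ0, hδ⟩ := exists_forall_hausdorffMeasure_image_lt hk hφ hA hO hu hm hD hloc hKO hK hε
  refine (hδ _ inter_subset_left ?_).le
  rwa [measure_mono_null inter_subset_right hE]

/-- The exceptional points of `E`, where `h` does not vanish, form a null set, whose image is null
by the `(N)`-property. -/
theorem hausdorffMeasure_image_eq_zero_of_ae (hk : 2 ≤ k) (hφ : MonotoneOn φ (Ici 0))
    (hφ0 : φ 0 = 0)
    (hA : orliczSum φ k < ⊤) (hO : IsOpen O) (hu : ContinuousOn u O) (hm : Measurable h)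
    (hD : IsDyadicGradientBound O u fun x => ENNReal.ofReal (h x))
    (hloc : ∀ K ⊆ O, IsCompact K → ∫⁻ z in K, orliczWeight φ (h z) < ⊤)
    {E : Set (Fin k → ℝ)} (hEO : E ⊆ O) (hE : ∀ᵐ x : Fin k → ℝ, x ∈ E → h x = 0) :
    Measure.hausdorffMeasure k (u '' E) = 0 := by
  have h1 : Measure.hausdorffMeasure k (u '' (E ∩ {x | h x = 0})) = 0 := by
    refine hausdorffMeasure_image_eq_zero_of_forall_isCompact hO (inter_subset_left.trans hEO)
      fun K hKO hK => measure_mono_null (image_mono ?_)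
        (hausdorffMeasure_image_eq_zero_of_isCompact hk hφ hφ0 hA hO hu hm hD hloc hKO hK)
    exact inter_subset_inter_right K inter_subset_right
  have h2 : Measure.hausdorffMeasure k (u '' (E \ {x | h x = 0})) = 0 := by
    refine hausdorffMeasure_image_eq_zero_of_volume_eq_zero hk hφ hA hO hu hm hD hloc
      (sdiff_subset.trans hEO) (measure_mono_null (fun x hx => ?_) (ae_iff.1 hE))
    exact fun hcon => hx.2 (hcon hx.1)
  rw [← inter_union_sdiff E {x | h x = 0}, image_union]
  exact measure_union_null h1 h2

end

/-! ### Differences of a weakly differentiable function along a fixed vector -/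

section
variable {n m : ℕ} {U : Set (EuclideanSpace ℝ (Fin n))}
  {f : EuclideanSpace ℝ (Fin n) → EuclideanSpace ℝ (Fin m)}
  {g g' : EuclideanSpace ℝ (Fin n) →
    EuclideanSpace ℝ (Fin n) →L[ℝ] EuclideanSpace ℝ (Fin m)}

theorem IsWeakDeriv.congr (hU : MeasurableSet U) (hW : IsWeakDeriv U f g)
    (h : ∀ᵐ x, x ∈ U → g x = g' x) : IsWeakDeriv U f g' := by
  have hae : g =ᵐ[volume.restrict U] g' := (ae_restrict_iff' hU).2 h
  refine ⟨hW.locallyIntegrableOn, fun x hx => ?_, fun ψ hψ hψc hψU v => ?_⟩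
  · obtain ⟨s, hs, hint⟩ := hW.locallyIntegrableOn_deriv x hx
    refine ⟨s ∩ U, Filter.inter_mem hs self_mem_nhdsWithin, ?_⟩
    have h1 : IntegrableOn g (s ∩ U) := hint.mono_set inter_subset_left
    exact h1.congr_fun_ae (ae_mono (Measure.restrict_mono inter_subset_right le_rfl) hae)
  · rw [hW.integral_eq ψ hψ hψc hψU v]
    congr 1
    refine integral_congr_ae ?_
    filter_upwards [h] with x hx
    by_cases hxU : x ∈ U
    · rw [hx hxU]
    · rw [image_eq_zero_of_notMem_tsupport (fun hc => hxU (hψU hc)), zero_smul, zero_smul]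

theorem IsWeakDeriv.exists_stronglyMeasurable (hU : IsOpen U) (hW : IsWeakDeriv U f g) :
    ∃ G, StronglyMeasurable G ∧ (∀ᵐ x, x ∈ U → g x = G x) ∧ IsWeakDeriv U f G := by
  have hm := hW.locallyIntegrableOn_deriv.aestronglyMeasurable
  have hae := (ae_restrict_iff' hU.measurableSet).1 hm.ae_eq_mk
  exact ⟨hm.mk g, hm.stronglyMeasurable_mk, hae, hW.congr hU.measurableSet hae⟩

/-- A test function times a function that is locally integrable on an open set containing its
support is integrable. -/
theorem integrable_smul_of_tsupport_subset {F : Type*} [NormedAddCommGroup F] [NormedSpace ℝ F]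
    {w : EuclideanSpace ℝ (Fin n) → F} (hw : LocallyIntegrableOn w U)
    {ψ : EuclideanSpace ℝ (Fin n) → ℝ} (hψ : Continuous ψ) (hc : HasCompactSupport ψ)
    (hs : tsupport ψ ⊆ U) : Integrable fun x => ψ x • w x := by
  have hK : IsCompact (tsupport ψ) := hc
  have h1 : IntegrableOn (fun x => ψ x • w x) (tsupport ψ) :=
    (hw.integrableOn_compact_subset hs hK).continuousOn_smul hψ.continuousOn hK
  refine (integrableOn_iff_integrable_of_support_subset fun x hx => ?_).1 h1
  by_contra hcon
  exact hx (by simp [image_eq_zero_of_notMem_tsupport hcon])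

theorem IsWeakDeriv.ae_eq (hU : IsOpen U) (hg : IsWeakDeriv U f g) (hg' : IsWeakDeriv U f g') :
    ∀ᵐ x, x ∈ U → g x = g' x := by
  have key : ∀ v : EuclideanSpace ℝ (Fin n), ∀ᵐ x, x ∈ U → (g x - g' x) v = 0 := by
    intro v
    have hloc : ∀ {G : EuclideanSpace ℝ (Fin n) →
        EuclideanSpace ℝ (Fin n) →L[ℝ] EuclideanSpace ℝ (Fin m)}, LocallyIntegrableOn G U →
        LocallyIntegrableOn (fun x => G x v) U := fun hG x hx => by
      obtain ⟨s, hs, hint⟩ := hG x hx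
      exact ⟨s, hs, hint.apply_continuousLinearMap v⟩
    have h1 := hloc hg.locallyIntegrableOn_deriv
    have h2 := hloc hg'.locallyIntegrableOn_deriv
    refine hU.ae_eq_zero_of_integral_contDiff_smul_eq_zero (f := fun x => (g x - g' x) v) ?_ ?_
    · exact h1.sub h2
    · intro ψ hψ hψc hψU
      have e1 := hg.integral_eq ψ hψ hψc hψU v
      rw [hg'.integral_eq ψ hψ hψc hψU v, neg_inj] at e1
      simp only [_root_.sub_apply, smul_sub]
      rw [integral_sub (integrable_smul_of_tsupport_subset h1 hψ.continuous hψc hψU)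
        (integrable_smul_of_tsupport_subset h2 hψ.continuous hψc hψU), e1, sub_self]
  have hall : ∀ᵐ x, ∀ j : Fin n, x ∈ U → (g x - g' x) (EuclideanSpace.single j 1) = 0 :=
    ae_all_iff.2 fun j => key _
  filter_upwards [hall] with x hx hxU
  rw [← sub_eq_zero]
  refine ContinuousLinearMap.coe_injective
    ((EuclideanSpace.basisFun (Fin n) ℝ).toBasis.ext fun j => ?_)
  simpa using hx j hxU

/-- The line segments from points near `x₀` in the direction of `v` stay in a compact subset of
`U` if the one from `x₀` does. -/
theorem exists_isCompact_segments_subset (hU : IsOpen U) {x₀ v : EuclideanSpace ℝ (Fin n)}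
    (h : ∀ τ ∈ Icc (0 : ℝ) 1, x₀ + τ • v ∈ U) :
    ∃ r > 0, ∃ K ⊆ U, IsCompact K ∧
      ∀ x ∈ Metric.ball x₀ r, ∀ τ ∈ Icc (0 : ℝ) 1, x + τ • v ∈ K := by
  set S := (fun τ : ℝ => x₀ + τ • v) '' Icc (0 : ℝ) 1 with hS
  have hSc : IsCompact S := isCompact_Icc.image (by fun_prop)
  have hSU : S ⊆ U := by
    rintro _ ⟨τ, hτ, rfl⟩
    exact h τ hτ
  obtain ⟨r, hr, hrU⟩ := hSc.exists_cthickening_subset_open hU hSU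
  refine ⟨r, hr, Metric.cthickening r S, hrU, hSc.cthickening, fun x hx τ hτ => ?_⟩
  refine Metric.mem_cthickening_of_dist_le _ (x₀ + τ • v) r S ⟨τ, hτ, rfl⟩ ?_
  rw [dist_add_right]
  exact (Metric.mem_ball.1 hx).le

theorem integrable_prod_translate {w : EuclideanSpace ℝ (Fin n) → EuclideanSpace ℝ (Fin m)}
    (hw : Integrable w) (v : EuclideanSpace ℝ (Fin n)) :
    Integrable (fun p : ℝ × EuclideanSpace ℝ (Fin n) => w (p.2 + p.1 • v))
      ((volume.restrict (Icc (0 : ℝ) 1)).prod volume) := by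
  have hmp : MeasurePreserving (fun p : ℝ × EuclideanSpace ℝ (Fin n) => (p.1, p.2 + p.1 • v))
      ((volume.restrict (Icc (0 : ℝ) 1)).prod volume)
      ((volume.restrict (Icc (0 : ℝ) 1)).prod volume) := by
    refine (MeasurePreserving.id _).skew_product (g := fun τ x => x + τ • v)
      (by fun_prop) (Filter.Eventually.of_forall fun τ => ?_)
    exact (measurePreserving_add_right volume (τ • v)).map_eq
  have h0 := hw.comp_snd (volume.restrict (Icc (0 : ℝ) 1))
  exact hmp.integrable_comp_of_integrable h0

/-- Testing the weak derivative against the translates of `ψ` along `v` and integrating. -/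
theorem integral_smul_sub_translate_eq {fK : EuclideanSpace ℝ (Fin n) → EuclideanSpace ℝ (Fin m)}
    {gv : EuclideanSpace ℝ (Fin n) → EuclideanSpace ℝ (Fin m)} (hf : Integrable fK)
    (hg : Integrable gv) (v : EuclideanSpace ℝ (Fin n)) {ψ : EuclideanSpace ℝ (Fin n) → ℝ}
    (hψ : ContDiff ℝ ∞ ψ) (hψc : HasCompactSupport ψ)
    (hweak : ∀ τ ∈ Icc (0 : ℝ) 1,
      ∫ x, fderiv ℝ ψ (x - τ • v) v • fK x = -∫ x, ψ (x - τ • v) • gv x) :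
    ∫ x, ψ x • (fK (x + v) - fK x - ∫ τ in Icc (0 : ℝ) 1, gv (x + τ • v)) = 0 := by
  have hψb : ∃ C, ∀ x, ‖ψ x‖ ≤ C := hψc.exists_bound_of_continuous hψ.continuous
  obtain ⟨C, hC⟩ := hψb
  have hdψ : Continuous fun x => fderiv ℝ ψ x v :=
    (hψ.continuous_fderiv (by simp)).clm_apply continuous_const
  obtain ⟨D, hD⟩ : ∃ D, ∀ x, ‖fderiv ℝ ψ x v‖ ≤ D :=
    (hψc.fderiv_apply (𝕜 := ℝ) v).exists_bound_of_continuous hdψ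
  have hψf : Integrable fun x => ψ x • fK x :=
    hf.bdd_smul C hψ.continuous.aestronglyMeasurable (Filter.Eventually.of_forall hC)
  have hψfs : Integrable fun x => ψ (x - v) • fK x :=
    hf.bdd_smul C (by fun_prop) (Filter.Eventually.of_forall fun x => hC _)
  have hψft : Integrable fun x => ψ x • fK (x + v) :=
    (hf.comp_add_right v).bdd_smul C hψ.continuous.aestronglyMeasurable
      (Filter.Eventually.of_forall hC)
  have hgprod := integrable_prod_translate hg v
  have hψg : Integrable (fun p : ℝ × EuclideanSpace ℝ (Fin n) => ψ p.2 • gv (p.2 + p.1 • v))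
      ((volume.restrict (Icc (0 : ℝ) 1)).prod volume) :=
    hgprod.bdd_smul C (by fun_prop) (Filter.Eventually.of_forall fun p => hC _)
  have hdf : Integrable
      (fun p : ℝ × EuclideanSpace ℝ (Fin n) => fderiv ℝ ψ (p.2 - p.1 • v) v • fK p.2)
      ((volume.restrict (Icc (0 : ℝ) 1)).prod volume) :=
    (hf.comp_snd _).bdd_smul D (hdψ.comp (by fun_prop)).aestronglyMeasurable
      (Filter.Eventually.of_forall fun p => hD _)
  have hFTC : ∀ x, ψ (x - v) - ψ x = -∫ τ in Icc (0 : ℝ) 1, fderiv ℝ ψ (x - τ • v) v := by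
    intro x
    have hderiv : ∀ τ ∈ uIcc (0 : ℝ) 1,
        HasDerivAt (fun τ : ℝ => ψ (x - τ • v)) (-fderiv ℝ ψ (x - τ • v) v) τ := by
      intro τ _
      have h1 : HasDerivAt (fun τ : ℝ => x - τ • v) (-v) τ := by
        simpa using ((hasDerivAt_id τ).smul_const v).const_sub x
      have h2 := (hψ.differentiable (by simp) (x - τ • v)).hasFDerivAt.comp_hasDerivAt τ h1
      rw [map_neg] at h2
      exact h2
    have h3 := intervalIntegral.integral_eq_sub_of_hasDerivAt hderiv
      ((hdψ.comp (by fun_prop : Continuous fun τ : ℝ => x - τ • v)).neg.intervalIntegrable _ _)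
    rw [intervalIntegral.integral_neg, intervalIntegral.integral_of_le zero_le_one,
      ← integral_Icc_eq_integral_Ioc] at h3
    simpa using h3.symm
  have hleft : ∫ x, ψ x • (fK (x + v) - fK x) =
      ∫ τ in Icc (0 : ℝ) 1, ∫ x, ψ (x - τ • v) • gv x := by
    calc ∫ x, ψ x • (fK (x + v) - fK x) = ∫ x, (ψ (x - v) - ψ x) • fK x := by
          simp only [smul_sub, sub_smul]
          rw [integral_sub hψft hψf, integral_sub hψfs hψf]
          congr 1
          rw [← integral_add_right_eq_self (fun x => ψ (x - v) • fK x) v]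
          simp only [add_sub_cancel_right]
      _ = -∫ x, ∫ τ in Icc (0 : ℝ) 1, fderiv ℝ ψ (x - τ • v) v • fK x := by
          rw [← integral_neg]
          refine integral_congr_ae (Filter.Eventually.of_forall fun x => ?_)
          dsimp only
          rw [hFTC, neg_smul, integral_smul_const]
      _ = -∫ τ in Icc (0 : ℝ) 1, ∫ x, fderiv ℝ ψ (x - τ • v) v • fK x := by
          rw [integral_integral_swap]
          exact hdf.swap
      _ = _ := by
          rw [← integral_neg]
          refine setIntegral_congr_fun measurableSet_Icc fun τ hτ => ?_
          beta_reduce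
          rw [hweak τ hτ, neg_neg]
  have hright : ∫ x, ψ x • ∫ τ in Icc (0 : ℝ) 1, gv (x + τ • v) =
      ∫ τ in Icc (0 : ℝ) 1, ∫ x, ψ (x - τ • v) • gv x := by
    calc ∫ x, ψ x • ∫ τ in Icc (0 : ℝ) 1, gv (x + τ • v)
        = ∫ x, ∫ τ in Icc (0 : ℝ) 1, ψ x • gv (x + τ • v) := by
          simp only [integral_smul]
      _ = ∫ τ in Icc (0 : ℝ) 1, ∫ x, ψ x • gv (x + τ • v) := by
          rw [integral_integral_swap]
          exact hψg.swap
      _ = _ := by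
          refine integral_congr_ae (Filter.Eventually.of_forall fun τ => ?_)
          dsimp only
          rw [← integral_add_right_eq_self (fun x => ψ (x - τ • v) • gv x) (τ • v)]
          simp only [add_sub_cancel_right]
  have hint : Integrable fun x => ψ x • ∫ τ in Icc (0 : ℝ) 1, gv (x + τ • v) := by
    have := hψg.swap.integral_prod_left
    simpa only [Function.comp_apply, Prod.swap, integral_smul] using this
  simp only [smul_sub (ψ _) (_ - _)]
  rw [integral_sub ((hψft.sub hψf).congr
    (Filter.Eventually.of_forall fun x => (smul_sub _ _ _).symm)) hint, hleft, hright, sub_self]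

/-- The fundamental theorem of calculus along a fixed vector `v`, almost everywhere. -/
theorem IsWeakDeriv.ae_sub_eq_integral (hU : IsOpen U) (hW : IsWeakDeriv U f g)
    (v : EuclideanSpace ℝ (Fin n)) :
    ∀ᵐ x, (∀ τ ∈ Icc (0 : ℝ) 1, x + τ • v ∈ U) →
      f (x + v) - f x = ∫ τ in Icc (0 : ℝ) 1, g (x + τ • v) v := by
  rw [ae_iff]
  refine measure_null_of_locally_null _ fun x₀ hx₀ => ?_
  obtain ⟨hx₀U, -⟩ := Classical.not_imp.1 hx₀
  obtain ⟨r, hr, K, hKU, hK, hball⟩ := exists_isCompact_segments_subset hU hx₀U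
  have hfint : Integrable (K.indicator f) := (integrable_indicator_iff hK.measurableSet).2
    (hW.locallyIntegrableOn.integrableOn_compact_subset hKU hK)
  have hgint : Integrable (K.indicator fun x => g x v) :=
    (integrable_indicator_iff hK.measurableSet).2
      ((hW.locallyIntegrableOn_deriv.integrableOn_compact_subset hKU hK).apply_continuousLinearMap
      v)
  have hmain : ∀ᵐ x, x ∈ Metric.ball x₀ r →
      K.indicator f (x + v) - K.indicator f x -
        ∫ τ in Icc (0 : ℝ) 1, K.indicator (fun x => g x v) (x + τ • v) = 0 := by
    refine Metric.isOpen_ball.ae_eq_zero_of_integral_contDiff_smul_eq_zero ?_ ?_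
    · have h3 := (integrable_prod_translate hgint v).swap.integral_prod_left
      exact (((hfint.comp_add_right v).sub hfint).sub h3).locallyIntegrable.locallyIntegrableOn _
    · intro ψ hψ hψc hψB
      refine integral_smul_sub_translate_eq hfint hgint v hψ hψc fun τ hτ => ?_
      have hsupp : tsupport (fun x => ψ (x - τ • v)) ⊆ K := by
        intro x hx
        have hx' : x - τ • v ∈ tsupport ψ :=
          tsupport_comp_subset_preimage ψ (f := fun x => x - τ • v) (by fun_prop) hx
        simpa using hball _ (hψB hx') τ hτ
      have hψτ : HasCompactSupport fun x => ψ (x - τ • v) :=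
        hψc.comp_homeomorph (Homeomorph.subRight (τ • v))
      have := hW.integral_eq (fun x => ψ (x - τ • v)) (hψ.comp (by fun_prop)) hψτ
        (hsupp.trans hKU) v
      convert this using 2
      · funext x
        rw [fderiv_comp_sub]
        by_cases hx : x ∈ K
        · rw [indicator_of_mem hx]
        · have h0 : fderiv ℝ (fun x => ψ (x - τ • v)) x = 0 :=
            image_eq_zero_of_notMem_tsupport fun hc => hx (hsupp (tsupport_fderiv_subset ℝ hc))
          rw [fderiv_comp_sub] at h0
          rw [h0]
          simp
      · congr 1
        funext x
        by_cases hx : x ∈ K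
        · rw [indicator_of_mem hx]
        · rw [image_eq_zero_of_notMem_tsupport (f := fun x => ψ (x - τ • v))
            fun hc => hx (hsupp hc), zero_smul, zero_smul]
  refine ⟨_, Filter.inter_mem self_mem_nhdsWithin
    (mem_nhdsWithin_of_mem_nhds (Metric.ball_mem_nhds x₀ hr)),
    measure_mono_null ?_ (ae_iff.1 hmain)⟩
  rintro x ⟨hx, hxB⟩ hcon
  refine hx fun _ => ?_
  have h := hcon hxB
  have hτ := hball x hxB
  have h0 : x ∈ K := by simpa using hτ 0 (by simp)
  have h1 : x + v ∈ K := by simpa using hτ 1 (by simp)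
  rw [indicator_of_mem h0, indicator_of_mem h1, sub_eq_zero] at h
  rw [h]
  exact setIntegral_congr_fun measurableSet_Icc fun τ hτ' => indicator_of_mem (hτ τ hτ') _

end

/-! ### The norm of the gradient -/

section
variable {n m : ℕ}

/-- The operator norm is at most the Hilbert–Schmidt norm. -/
theorem norm_apply_le_gradNorm (L : EuclideanSpace ℝ (Fin n) →L[ℝ] EuclideanSpace ℝ (Fin m))
    (v : EuclideanSpace ℝ (Fin n)) : ‖L v‖ ≤ gradNorm L * ‖v‖ := by
  have hLv : ∀ i, L v i = ∑ j, v j * L (EuclideanSpace.single j 1) i := by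
    intro i
    have hv : v = ∑ j, v j • EuclideanSpace.single j (1 : ℝ) := by
      simpa using ((EuclideanSpace.basisFun (Fin n) ℝ).sum_repr v).symm
    conv_lhs => rw [hv]
    simp
  rw [EuclideanSpace.norm_eq, EuclideanSpace.norm_eq, gradNorm, ← Real.sqrt_mul (by positivity)]
  refine Real.sqrt_le_sqrt ?_
  rw [Finset.sum_mul]
  refine Finset.sum_le_sum fun i _ => ?_
  simp only [Real.norm_eq_abs, sq_abs]
  rw [hLv i, mul_comm]
  exact Finset.sum_mul_sq_le_sq_mul_sq _ _ _

theorem eq_zero_of_gradNorm_eq_zero {L : EuclideanSpace ℝ (Fin n) →L[ℝ] EuclideanSpace ℝ (Fin m)}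
    (h : gradNorm L = 0) : L = 0 := by
  ext1 v
  have := norm_apply_le_gradNorm L v
  rw [h, zero_mul] at this
  simpa using this

theorem continuous_gradNorm : Continuous (gradNorm (n := n) (m := m)) := by
  unfold gradNorm
  fun_prop

end

/-! ### Coordinates adapted to a family of parallel hyperplanes -/

section
variable {k m : ℕ}

/-- The point whose coordinate along `b 0` is `t` and whose coordinates along the other vectors of
the orthonormal basis `b` are given by `y`. -/
noncomputable def slicePoint
    (b : OrthonormalBasis (Fin (k + 1)) ℝ (EuclideanSpace ℝ (Fin (k + 1)))) (t : ℝ)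
    (y : Fin k → ℝ) : EuclideanSpace ℝ (Fin (k + 1)) :=
  t • b 0 + ∑ i : Fin k, y i • b i.succ

/-- The coordinates of `x` along all vectors of the basis but the first. -/
noncomputable def sliceCoord
    (b : OrthonormalBasis (Fin (k + 1)) ℝ (EuclideanSpace ℝ (Fin (k + 1))))
    (x : EuclideanSpace ℝ (Fin (k + 1))) : Fin k → ℝ :=
  fun i => inner ℝ (b i.succ) x

variable (b : OrthonormalBasis (Fin (k + 1)) ℝ (EuclideanSpace ℝ (Fin (k + 1))))

theorem exists_orthonormalBasis_apply_zero {ν : EuclideanSpace ℝ (Fin (k + 1))} (hν : ‖ν‖ = 1) :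
    ∃ b : OrthonormalBasis (Fin (k + 1)) ℝ (EuclideanSpace ℝ (Fin (k + 1))), b 0 = ν := by
  have horth : Orthonormal ℝ (({0} : Set (Fin (k + 1))).domRestrict fun _ => ν) := by
    refine ⟨fun _ => hν, fun i j hij => (hij (Subsingleton.elim i j)).elim⟩
  obtain ⟨b, hb⟩ := horth.exists_orthonormalBasis_extension_of_card_eq (by simp)
  exact ⟨b, hb 0 rfl⟩

theorem measurePreserving_slicePoint :
    MeasurePreserving fun p : ℝ × (Fin k → ℝ) => slicePoint b p.1 p.2 := by
  have h1 := (volume_preserving_piFinSuccAbove (fun _ : Fin (k + 1) => ℝ) 0).symm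
  have h2 := PiLp.volume_preserving_toLp (Fin (k + 1))
  have h3 := b.measurePreserving_repr_symm
  have heq : (fun p : ℝ × (Fin k → ℝ) => slicePoint b p.1 p.2) = b.repr.symm ∘ WithLp.toLp 2 ∘
      (MeasurableEquiv.piFinSuccAbove (fun _ : Fin (k + 1) => ℝ) 0).symm := by
    funext p
    simp only [Function.comp_apply]
    rw [← b.sum_repr_symm, Fin.sum_univ_succ]
    simp [slicePoint, MeasurableEquiv.piFinSuccAbove]
  rw [heq]
  exact h3.comp (h2.comp h1)

theorem continuous_slicePoint :
    Continuous fun p : ℝ × (Fin k → ℝ) => slicePoint b p.1 p.2 := by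
  unfold slicePoint
  fun_prop

theorem slicePoint_add_smul (t τ : ℝ) (y w : Fin k → ℝ) :
    slicePoint b t (y + τ • w) = slicePoint b t y + τ • slicePoint b 0 w := by
  simp only [slicePoint, Pi.add_apply, Pi.smul_apply, add_smul, Finset.sum_add_distrib, zero_smul,
    zero_add, Finset.smul_sum, smul_assoc, add_assoc]

theorem slicePoint_sliceCoord (x : EuclideanSpace ℝ (Fin (k + 1))) :
    slicePoint b (inner ℝ (b 0) x) (sliceCoord b x) = x := by
  conv_rhs => rw [← b.sum_repr' x, Fin.sum_univ_succ]
  rfl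

theorem lipschitzWith_sliceCoord : LipschitzWith 1 (sliceCoord b) := by
  refine LipschitzWith.of_dist_le_mul fun x y => ?_
  rw [NNReal.coe_one, one_mul]
  refine (dist_pi_le_iff dist_nonneg).2 fun i => ?_
  rw [Real.dist_eq, sliceCoord, sliceCoord, ← inner_sub_right, dist_eq_norm]
  refine (abs_real_inner_le_norm _ _).trans ?_
  rw [b.norm_eq_one, one_mul]

/-- Lebesgue measure on `ℝᵏ` is the `k`-dimensional Hausdorff measure of the sup norm, and the
coordinate map does not increase distances. -/
theorem volume_image_sliceCoord_le (E : Set (EuclideanSpace ℝ (Fin (k + 1)))) :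
    volume (sliceCoord b '' E) ≤ Measure.hausdorffMeasure k E := by
  have h := (lipschitzWith_sliceCoord b).hausdorffMeasure_image_le (d := (k : ℝ)) (by positivity) E
  have hvol := hausdorffMeasure_pi_real (ι := Fin k)
  rw [Fintype.card_fin] at hvol
  rw [hvol] at h
  simpa using h

/-- The part of the set `U` in the hyperplane at height `t`, in coordinates. -/
def sliceSet (U : Set (EuclideanSpace ℝ (Fin (k + 1)))) (t : ℝ) : Set (Fin k → ℝ) :=
  {y | slicePoint b t y ∈ U}

/-- The norm of the derivative in the directions of the hyperplane: the largest `‖L (b i)‖` over the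
vectors `b i` of the basis that span it. -/
noncomputable def tangentialNorm
    (L : EuclideanSpace ℝ (Fin (k + 1)) →L[ℝ] EuclideanSpace ℝ (Fin m)) : ℝ :=
  ‖fun i : Fin k => L (b i.succ)‖

theorem tangentialNorm_nonneg
    (L : EuclideanSpace ℝ (Fin (k + 1)) →L[ℝ] EuclideanSpace ℝ (Fin m)) :
    0 ≤ tangentialNorm b L := norm_nonneg _

theorem continuous_tangentialNorm : Continuous (tangentialNorm (m := m) b) := by
  unfold tangentialNorm
  fun_prop

theorem gradNorm_nonneg {n : ℕ} (L : EuclideanSpace ℝ (Fin n) →L[ℝ] EuclideanSpace ℝ (Fin m)) :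
    0 ≤ gradNorm L := Real.sqrt_nonneg _

theorem tangentialNorm_le_gradNorm
    (L : EuclideanSpace ℝ (Fin (k + 1)) →L[ℝ] EuclideanSpace ℝ (Fin m)) :
    tangentialNorm b L ≤ gradNorm L := by
  refine (pi_norm_le_iff_of_nonneg (gradNorm_nonneg L)).2 fun i => ?_
  simpa using norm_apply_le_gradNorm L (b i.succ)

theorem norm_apply_slicePoint_zero_le
    (L : EuclideanSpace ℝ (Fin (k + 1)) →L[ℝ] EuclideanSpace ℝ (Fin m)) (w : Fin k → ℝ) :
    ‖L (slicePoint b 0 w)‖ ≤ k * ‖w‖ * tangentialNorm b L := by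
  simp only [slicePoint, zero_smul, zero_add, map_sum, map_smul]
  calc ‖∑ i, w i • L (b i.succ)‖ ≤ ∑ _i : Fin k, ‖w‖ * tangentialNorm b L := by
        refine norm_sum_le_of_le _ fun i _ => ?_
        rw [norm_smul]
        exact mul_le_mul (norm_le_pi_norm w i)
          (norm_le_pi_norm (fun i : Fin k => L (b i.succ)) i) (norm_nonneg _) (norm_nonneg _)
    _ = _ := by
        rw [Finset.sum_const, Finset.card_univ, Fintype.card_fin, nsmul_eq_mul, mul_assoc]

theorem ae_ae_slicePoint {P : EuclideanSpace ℝ (Fin (k + 1)) → Prop} (h : ∀ᵐ x, P x) :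
    ∀ᵐ t : ℝ, ∀ᵐ y : Fin k → ℝ, P (slicePoint b t y) :=
  Measure.ae_ae_of_ae_prod ((measurePreserving_slicePoint b).quasiMeasurePreserving.ae h)

end

/-! ### Restriction to almost every hyperplane -/

section
variable {k m : ℕ} (b : OrthonormalBasis (Fin (k + 1)) ℝ (EuclideanSpace ℝ (Fin (k + 1))))
  {U : Set (EuclideanSpace ℝ (Fin (k + 1)))}
  {f : EuclideanSpace ℝ (Fin (k + 1)) → EuclideanSpace ℝ (Fin m)}
  {g : EuclideanSpace ℝ (Fin (k + 1)) →
    EuclideanSpace ℝ (Fin (k + 1)) →L[ℝ] EuclideanSpace ℝ (Fin m)}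

theorem isOpen_sliceSet (hU : IsOpen U) (t : ℝ) : IsOpen (sliceSet b U t) :=
  hU.preimage ((continuous_slicePoint b).comp (by fun_prop : Continuous fun y => (t, y)))

theorem ae_isDyadicGradientBound (hU : IsOpen U) (hW : IsWeakDeriv U f g) :
    ∀ᵐ t : ℝ, IsDyadicGradientBound (sliceSet b U t) (fun y => f (slicePoint b t y))
      fun y => ENNReal.ofReal (tangentialNorm b (g (slicePoint b t y))) := by
  unfold IsDyadicGradientBound
  refine ae_all_iff.2 fun j => ae_all_iff.2 fun c => ?_
  set w : Fin k → ℝ := dyadicPoint j c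
  filter_upwards [ae_ae_slicePoint b (hW.ae_sub_eq_integral hU (slicePoint b 0 w))] with t ht
  filter_upwards [ht] with y hy hseg
  have hone : slicePoint b t (y + w) = slicePoint b t y + slicePoint b 0 w := by
    simpa using slicePoint_add_smul b t 1 y w
  rw [hone, hy fun τ hτ => by
    rw [← slicePoint_add_smul]
    exact hseg τ hτ]
  refine (enorm_integral_le_lintegral_enorm _).trans ?_
  rw [← lintegral_const_mul' _ _ (by finiteness)]
  refine lintegral_mono fun τ => ?_
  rw [slicePoint_add_smul, ← ofReal_norm, ← ofReal_norm, ← ENNReal.ofReal_natCast,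
    ← ENNReal.ofReal_mul (by positivity), ← ENNReal.ofReal_mul (by positivity)]
  exact ENNReal.ofReal_le_ofReal (norm_apply_slicePoint_zero_le b _ w)

/-- By Fubini the weight is integrable over almost every slice of each set of a countable compact
exhaustion of `U`, and every compact subset of a slice of `U` lies in one of these. -/
theorem ae_forall_setLIntegral_orliczWeight_lt_top {φ : ℝ → ℝ} (hφ : MonotoneOn φ (Ici 0))
    (hU : IsOpen U) (hg : StronglyMeasurable g)
    (hint : ∀ K ⊆ U, IsCompact K → ∫⁻ x in K, ENNReal.ofReal (φ (gradNorm (g x))) < ⊤) :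
    ∀ᵐ t : ℝ, ∀ L ⊆ sliceSet b U t, IsCompact L →
      ∫⁻ y in L, orliczWeight φ (tangentialNorm b (g (slicePoint b t y))) < ⊤ := by
  obtain ⟨K, hKc, hKU, hK⟩ := exists_nat_isCompact_exhaustion hU
  have hGm : Measurable fun x => gradNorm (g x) := continuous_gradNorm.measurable.comp hg.measurable
  have hwm : Measurable fun x => orliczWeight φ (gradNorm (g x)) :=
    measurable_orliczWeight_comp hφ hGm fun x => gradNorm_nonneg _
  have hKint : ∀ i, ∫⁻ x in K i, orliczWeight φ (gradNorm (g x)) < ⊤ := by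
    intro i
    calc ∫⁻ x in K i, orliczWeight φ (gradNorm (g x))
        ≤ ∫⁻ x in K i, (1 + ENNReal.ofReal (φ (gradNorm (g x)))) := by
          refine lintegral_mono fun x => ?_
          unfold orliczWeight
          gcongr
          split_ifs <;> simp
      _ = volume (K i) + ∫⁻ x in K i, ENNReal.ofReal (φ (gradNorm (g x))) := by
          rw [lintegral_add_left measurable_const, setLIntegral_one]
      _ < ⊤ := ENNReal.add_lt_top.2 ⟨(hKc i).measure_lt_top, hint _ (hKU i) (hKc i)⟩
  have hslice : ∀ᵐ t : ℝ, ∀ i, ∫⁻ y : Fin k → ℝ,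
      (K i).indicator (fun x => orliczWeight φ (gradNorm (g x))) (slicePoint b t y) < ⊤ := by
    refine ae_all_iff.2 fun i => ?_
    have hm : Measurable ((K i).indicator fun x => orliczWeight φ (gradNorm (g x))) :=
      hwm.indicator (hKc i).measurableSet
    have hmp := measurePreserving_slicePoint b
    refine ae_lt_top ((hm.comp hmp.measurable).lintegral_prod_right') ?_
    have h1 := hmp.lintegral_comp hm
    rw [Measure.volume_eq_prod,
      lintegral_prod (fun p : ℝ × (Fin k → ℝ) => (K i).indicator
        (fun x => orliczWeight φ (gradNorm (g x))) (slicePoint b p.1 p.2))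
        (hm.comp hmp.measurable).aemeasurable, lintegral_indicator (hKc i).measurableSet] at h1
    exact (h1.trans_lt (hKint i)).ne
  filter_upwards [hslice] with t ht L hL hLc
  have hcont : Continuous (slicePoint b t) :=
    (continuous_slicePoint b).comp (by fun_prop : Continuous fun y => (t, y))
  obtain ⟨i, hi⟩ := hK (slicePoint b t '' L) (image_subset_iff.2 hL) (hLc.image hcont)
  refine lt_of_le_of_lt ?_ (ht i)
  rw [← lintegral_indicator hLc.measurableSet]
  refine lintegral_mono fun y => ?_
  by_cases hy : y ∈ L
  · rw [indicator_of_mem hy, indicator_of_mem (hi (mem_image_of_mem _ hy))]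
    exact orliczWeight_mono hφ (tangentialNorm_nonneg b _) (tangentialNorm_le_gradNorm b _)
  · rw [indicator_of_notMem hy]
    exact zero_le

theorem image_comp_slicePoint {E : Set (EuclideanSpace ℝ (Fin (k + 1)))} {t : ℝ}
    (hE : E ⊆ hyperplane (b 0) t) :
    (fun y => f (slicePoint b t y)) '' (sliceCoord b '' E) = f '' E := by
  rw [image_image]
  refine image_congr fun x hx => ?_
  have hxt : inner ℝ (b 0) x = t := hE hx
  rw [← hxt, slicePoint_sliceCoord]

theorem image_sliceCoord_subset {E : Set (EuclideanSpace ℝ (Fin (k + 1)))} {t : ℝ}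
    (hE : E ⊆ hyperplane (b 0) t ∩ U) : sliceCoord b '' E ⊆ sliceSet b U t := by
  rintro _ ⟨x, hx, rfl⟩
  have hxt : inner ℝ (b 0) x = t := (hE hx).1
  rw [sliceSet, mem_ofPred_eq, ← hxt, slicePoint_sliceCoord]
  exact (hE hx).2

/-- The theorem in dimension `n = k + 1`, for a class `W^{1,φ}_loc`. The gradient is replaced by a
representative that is measurable everywhere, hence on every hyperplane. -/
theorem lusinSardOnHyperplanes_of_memOrliczSobolevLoc (hk : 2 ≤ k) (hU : IsOpen U)
    {ν : EuclideanSpace ℝ (Fin (k + 1))} (hν : ‖ν‖ = 1) {φ : ℝ → ℝ} (hφ : MonotoneOn φ (Ici 0))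
    (hφ0 : φ 0 = 0)
    (hint : ∫⁻ t in Ioi (1 : ℝ),
      (ENNReal.ofReal t / ENNReal.ofReal (φ t)) ^ (1 / ((k : ℝ) - 1)) < ⊤)
    (hf : ContinuousOn f U) (hmem : MemOrliczSobolevLoc φ U f) :
    LusinSardOnHyperplanes U f ν := by
  obtain ⟨b, rfl⟩ := exists_orthonormalBasis_apply_zero hν
  obtain ⟨g₀, hg₀, hg₀int⟩ := hmem
  obtain ⟨G, hGm, hGae, hG⟩ := hg₀.exists_stronglyMeasurable hU
  have hGint : ∀ K ⊆ U, IsCompact K → ∫⁻ x in K, ENNReal.ofReal (φ (gradNorm (G x))) < ⊤ := by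
    intro K hKU hK
    refine lt_of_eq_of_lt (setLIntegral_congr_fun_ae hK.measurableSet ?_) (hg₀int K hKU hK)
    filter_upwards [hGae] with x hx hxK
    rw [hx (hKU hxK)]
  have hA := orliczSum_lt_top hk hφ hint
  have hcast : ((k + 1 : ℕ) : ℝ) - 1 = k := by
    push_cast
    ring
  have hD := ae_isDyadicGradientBound b hU hG
  have hloc := ae_forall_setLIntegral_orliczWeight_lt_top b hφ hU hGm hGint
  have hcont : ∀ t, Continuous (slicePoint b t) := fun t =>
    (continuous_slicePoint b).comp (by fun_prop : Continuous fun y => (t, y))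
  have hu : ∀ t, ContinuousOn (fun y => f (slicePoint b t y)) (sliceSet b U t) := fun t =>
    hf.comp (hcont t).continuousOn fun y hy => hy
  have hhm : ∀ t, Measurable fun y => tangentialNorm b (G (slicePoint b t y)) := fun t =>
    (continuous_tangentialNorm b).measurable.comp (hGm.measurable.comp (hcont t).measurable)
  unfold LusinSardOnHyperplanes LusinN LocallyAC
  rw [hcast]
  refine ⟨?_, fun g hg => ?_⟩
  · filter_upwards [hD, hloc] with t hDt hloct
    refine ⟨fun E hE hE0 => ?_, fun K hK hKc ε hε => ?_⟩
    · rw [← image_comp_slicePoint b (hE.trans inter_subset_left)]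
      exact hausdorffMeasure_image_eq_zero_of_volume_eq_zero hk hφ hA (isOpen_sliceSet b hU t)
        (hu t) (hhm t) hDt hloct (image_sliceCoord_subset b hE)
        (le_antisymm ((volume_image_sliceCoord_le b E).trans hE0.le) zero_le)
    · obtain ⟨δ, hδ0, hδ⟩ := exists_forall_hausdorffMeasure_image_lt hk hφ hA
        (isOpen_sliceSet b hU t) (hu t) (hhm t) hDt hloct (image_sliceCoord_subset b hK)
        (hKc.image (lipschitzWith_sliceCoord b).continuous) hε
      refine ⟨δ, hδ0, fun E hEK hE => ?_⟩
      rw [← image_comp_slicePoint b ((hEK.trans hK).trans inter_subset_left)]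
      exact hδ _ (image_mono hEK) ((volume_image_sliceCoord_le b E).trans_lt hE)
  · filter_upwards [hD, hloc, ae_ae_slicePoint b (hG.ae_eq hU hg)] with t hDt hloct hgt E hE
    have htan : (∀ x ∈ E, ∀ v, inner ℝ (b 0) v = 0 → g x v = 0) →
        Measure.hausdorffMeasure k (f '' E) = 0 := by
      intro hzero
      rw [← image_comp_slicePoint b (hE.trans inter_subset_left)]
      refine hausdorffMeasure_image_eq_zero_of_ae hk hφ hφ0 hA (isOpen_sliceSet b hU t)
        (hu t) (hhm t) hDt hloct (image_sliceCoord_subset b hE) ?_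
      filter_upwards [hgt] with y hy hyE
      rw [hy (image_sliceCoord_subset b hE hyE)]
      obtain ⟨x, hx, rfl⟩ := hyE
      have hxt : inner ℝ (b 0) x = t := (hE hx).1
      rw [← hxt, slicePoint_sliceCoord, tangentialNorm, norm_eq_zero]
      funext i
      exact hzero x hx _ (b.orthonormal.2 (Fin.succ_ne_zero i).symm)
    refine ⟨fun hzero => htan fun x hx v _ => ?_, htan⟩
    rw [eq_zero_of_gradNorm_eq_zero (hzero x hx), zero_apply]

end

theorem lintegral_rpow_div_lt_top {p s : ℝ} (hs : 0 < s) (hp : s + 1 < p) :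
    ∫⁻ t in Ioi (1 : ℝ), (ENNReal.ofReal t / ENNReal.ofReal (t ^ p)) ^ (1 / s) < ⊤ := by
  have hexp : (1 - p) / s < -1 := by
    rw [div_lt_iff₀ hs]
    linarith
  have hint := (integrableOn_Ioi_rpow_of_lt hexp one_pos).lintegral_lt_top
  refine lt_of_eq_of_lt (setLIntegral_congr_fun measurableSet_Ioi fun t ht => ?_) hint
  have ht0 : 0 < t := one_pos.trans ht
  rw [← ENNReal.ofReal_div_of_pos (by positivity), ENNReal.ofReal_rpow_of_pos (by positivity)]
  congr 1
  nth_rewrite 1 [← Real.rpow_one t]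
  rw [← Real.rpow_sub ht0, ← Real.rpow_mul ht0.le, mul_one_div]

end OrliczSobolev

theorem theorem4p2 (n m : ℕ) (hn : 3 ≤ n) (hm : 1 ≤ m)
    (U : Set (EuclideanSpace ℝ (Fin n))) (hU : IsOpen U)
    (ν : EuclideanSpace ℝ (Fin n)) (hν : ‖ν‖ = 1) :
    (∀ φ : ℝ → ℝ, MonotoneOn φ (Set.Ici 0) → φ 0 = 0 →
      ∫⁻ t in Set.Ioi (1 : ℝ),
        (ENNReal.ofReal t / ENNReal.ofReal (φ t)) ^ (1 / ((n : ℝ) - 2)) < ⊤ →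
      ∀ f : EuclideanSpace ℝ (Fin n) → EuclideanSpace ℝ (Fin m),
        ContinuousOn f U → OrliczSobolev.MemOrliczSobolevLoc φ U f →
          OrliczSobolev.LusinSardOnHyperplanes U f ν) ∧
    (∀ p : ℝ, (n : ℝ) - 1 < p →
      ∀ f : EuclideanSpace ℝ (Fin n) → EuclideanSpace ℝ (Fin m),
        ContinuousOn f U → OrliczSobolev.MemSobolevLoc p U f →
          OrliczSobolev.LusinSardOnHyperplanes U f ν) := by
  obtain ⟨k, rfl⟩ := Nat.exists_eq_add_of_le' (show 1 ≤ n by omega)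
  have hk : 2 ≤ k := by omega
  have hk' : (2 : ℝ) ≤ k := by exact_mod_cast hk
  have hcast : ((k + 1 : ℕ) : ℝ) - 2 = (k : ℝ) - 1 := by
    push_cast
    ring
  have hcast' : ((k + 1 : ℕ) : ℝ) - 1 = (k : ℝ) := by
    push_cast
    ring
  rw [hcast, hcast']
  refine ⟨fun φ hφ hφ0 hint f hf hmem =>
    OrliczSobolev.lusinSardOnHyperplanes_of_memOrliczSobolevLoc hk hU hν hφ hφ0 hint hf hmem,
    fun p hp f hf hmem => ?_⟩
  have hp0 : 0 < p := by linarith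
  exact OrliczSobolev.lusinSardOnHyperplanes_of_memOrliczSobolevLoc hk hU hν
    (fun s hs t _ hst => Real.rpow_le_rpow hs hst hp0.le) (Real.zero_rpow hp0.ne')
    (OrliczSobolev.lintegral_rpow_div_lt_top (by linarith) (by linarith)) hf hmem
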